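/- **Setting.** Let $M\ge 2$, $N_\sigma,N_\gamma\ge 0$ be integers, and let $\Upsilon=[-\tfrac12,\tfrac12]^{N_\sigma+N_\gamma+2M}$ with $y=(y_\sigma,y_\gamma,y_E,y_z)\in\Upsilon$, where $y_E$ and $y_z$ have $M$ components each. Let $L>0$ and $\omega>0$ be given, together with the following. - For each $y_\gamma$, an $L$-periodic Lipschitz map $\gamma(\cdot,y_\gamma):\mathbb R\to\mathbb R^2$ parametrizing counterclockwise a closed curve $\Gamma^y$ without self-intersections, depending continuously on $y_\gamma$ in $C^{0,1}$. Let $D^y$ be the domain enclosed by $\Gamma^y$, and let $\Phi(\cdot,y_\gamma)$ be a bi-Lipschitz homeomorphism of $D^y$ onto the reference domain $D^0$ (the domain for $y_\gamma=0$). - Starting parameters $\theta(y_E)\in[0,L)^M$, continuous in $y_E$ when $L$ is identified with $0$. The electrode $E_m^y$ is the set of points of $\Gamma^y$ whose distance from $\gamma(\theta_m(y_E),y_\gamma)$ along $\Gamma^y$ in the counterclockwise direction lies in $(0,\omega)$. For all $j\ne k$ and all parameters, the counterclockwise distance along $\Gamma^y$ from $\gamma(\theta_j(y_E),y_\gamma)$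 to $\gamma(\theta_k(y_E),y_\gamma)$ is larger than $\omega$. - A continuous map $y_\sigma\mapsto\sigma_0(\cdot,y_\sigma)\in L^\infty(D^0)$ with $\operatorname{ess\,inf}\sigma_0(\cdot,y_\sigma)>0$ for all $y_\sigma$, and $\sigma^y=\sigma_0(\Phi(\cdot,y_\gamma),y_\sigma)$ on $D^y$. A continuous map $y_z\mapsto z(y_z)=z^y\in(0,\infty)^M$. Set $\varsigma_-=\min_{y_\sigma}\operatorname{ess\,inf}\sigma_0(\cdot,y_\sigma)$ and $\zeta_+=\max_m\max_{y_z}z_m(y_z)$. Let $C_{\rm tr}$ be the supremum over $y\in\Upsilon$ of the norms of the trace operators $H^1(D^y)\to L^2(\Gamma^y)$, and let $C_{\rm P}$ be the supremum over $y\in\Upsilon$ of the smallest constants $C_{y,{\rm P}}$ with $\|v-\bar v\|_{H^1(D^y)}\le C_{y,{\rm P}}\|\nabla v\|_{L^2(D^y)}$ for all $v\in H^1(D^y)$, where $\bar v$ is the mean of $v$ over $D^y$. Assume that $C_{\rm tr}$ and $C_{\rm P}$ are finite (the trace operators are in particular assumed to be defined on all of $H^1(D^y)$). Let $\mathcal H^y=(H^1(D^y)\oplus\mathbb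 R^M)/\mathbb R$ be the quotient by the pairs $(c,c\mathbf 1)$, $c\in\mathbb R$, with the norm $$\|(v,V)\|_{\mathcal H^y}^2=\inf_{c\in\mathbb R}\big(\|v-c\|_{H^1(D^y)}^2+|V-c\mathbf 1|^2\big),\qquad \|v\|_{H^1(D^y)}^2=\|v\|_{L^2(D^y)}^2+\|\nabla v\|_{L^2(D^y)}^2 .$$ **Corollary.** Let $I\in\mathbb R^M$ with $\sum_m I_m=0$. For every $y\in\Upsilon$ the complete electrode model $$\nabla\cdot(\sigma^y\nabla u^y)=0\ \text{in }D^y,\qquad \sigma^y\frac{\partial u^y}{\partial\nu}=0\ \text{on }\Gamma^y\setminus\overline{E^y},\quad E^y=\bigcup_{m} E^y_m,$$ $$u^y+z^y_m\sigma^y\frac{\partial u^y}{\partial\nu}=U^y_m\ \text{on }E^y_m,\qquad \int_{E^y_m}\sigma^y\frac{\partial u^y}{\partial\nu}\,dS=I_m,\qquad m=1,\dots,M,$$ understood weakly (the divergence in the sense of distributions, and $\sigma^y\partial u^y/\partial\nu\in L^2(\Gamma^y)$ defined by Green's formula), has exactly one solution $(u^y,U^y)\in\mathcal H^y$. The same element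 is the unique solution of the variational formulation $$\int_{D^y}\sigma^y\nabla u^y\cdot\nabla v\,dx+\sum_{m=1}^M\frac1{z^y_m}\int_{E^y_m}(U^y_m-u^y)(V_m-v)\,dS=I\cdot V\qquad\text{for all }(v,V)\in\mathcal H^y ,$$ and it satisfies the uniform bound $$\|(u^y,U^y)\|_{\mathcal H^y}\le\max\Big\{\frac{C_{\rm P}^2}{\varsigma_-}\Big(1+\frac{2C_{\rm tr}^2}{\omega}\Big),\frac{2\zeta_+}{\omega}\Big\}\,|I| .$$ -/

import Mathlib

open MeasureTheory Set Filter Topology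
open scoped ENNReal NNReal

noncomputable section

namespace CEM

/-- The Euclidean plane. -/
abbrev Plane := EuclideanSpace ℝ (Fin 2)

/-- The parameter hypercube `[-1/2, 1/2]^n`. -/
abbrev Cube (n : ℕ) := Fin n → Icc (-1 / 2 : ℝ) (1 / 2)

/-- The origin of the parameter hypercube. -/
def Cube.origin (n : ℕ) : Cube n := fun _ => ⟨0, by norm_num, by norm_num⟩

/-! ### Closed curves -/

/-- The trace of an `L`-periodic curve, `Γ = {γ(φ) | φ ∈ [0, L)}`. -/
def curveSet (L : ℝ) (γ : ℝ → Plane) : Set Plane := γ '' Ico 0 L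

/-- The domain enclosed by `Γ`: the points off `Γ` whose connected component in the complement of
`Γ` is bounded. -/
def enclosed (Γ : Set Plane) : Set Plane :=
  {x | x ∈ Γᶜ ∧ Bornology.IsBounded (connectedComponentIn Γᶜ x)}

/-- The arc length measure `dS` on the curve: the image of `|γ'(s)| ds` on `[0, L)` under `γ`. -/
def arcMeasure (L : ℝ) (γ : ℝ → Plane) : Measure Plane :=
  Measure.map γ ((volume.restrict (Ico 0 L)).withDensity fun s => ‖deriv γ s‖ₑ)

/-- The distance from `γ a` to `γ b` along the curve, in the direction of increasing parameters
(`a, b ∈ [0, L)`). -/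
def arcDist (L : ℝ) (γ : ℝ → Plane) (a b : ℝ) : ℝ :=
  ∫ s in a..(if a ≤ b then b else b + L), ‖deriv γ s‖

/-- `2π` times the winding number around `x` of the closed curve `γ`. -/
def windingIntegral (L : ℝ) (γ : ℝ → Plane) (x : Plane) : ℝ :=
  ∫ s in (0 : ℝ)..L,
    ((γ s 0 - x 0) * deriv γ s 1 - (γ s 1 - x 1) * deriv γ s 0) / ‖γ s - x‖ ^ 2

/-- The electrode of width `ω` starting at the curve parameter `θ`. -/
def electrode (L : ℝ) (γ : ℝ → Plane) (ω θ : ℝ) : Set Plane :=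
  {x | ∃ φ ∈ Ico 0 L, x = γ φ ∧ 0 < arcDist L γ θ φ ∧ arcDist L γ θ φ < ω}

/-! ### The Sobolev space `H¹(D)` -/

/-- Smooth functions with compact support in `D`. -/
def IsTestFunction (D : Set Plane) (φ : Plane → ℝ) : Prop :=
  ContDiff ℝ (⊤ : ℕ∞) φ ∧ HasCompactSupport φ ∧ tsupport φ ⊆ D

/-- `L²(D) × L²(D; ℝ²)` with the norm `(‖u‖² + ‖g‖²)^{1/2}`. -/
abbrev L2Pair (D : Set Plane) :=
  WithLp 2 (Lp ℝ 2 (volume.restrict D) × Lp Plane 2 (volume.restrict D))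

/-- `g` is the weak gradient of `u` in `D`. -/
def HasWeakGradient (D : Set Plane) (u : Plane → ℝ) (g : Plane → Plane) : Prop :=
  ∀ φ, IsTestFunction D φ → ∀ i : Fin 2,
    ∫ x in D, u x * gradient φ x i = -∫ x in D, g x i * φ x

lemma memLp_test {D : Set Plane} {φ : Plane → ℝ} (h : IsTestFunction D φ) :
    MemLp φ 2 (volume.restrict D) :=
  (h.1.continuous.memLp_of_hasCompactSupport h.2.1).restrict D

lemma gradient_eq (φ : Plane → ℝ) : gradient φ =
    fun x => (InnerProductSpace.toDual ℝ Plane).symm (fderiv ℝ φ x) := rfl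

lemma memLp_coord {D : Set Plane} {g : Plane → Plane} (hg : MemLp g 2 (volume.restrict D))
    (i : Fin 2) : MemLp (fun x => g x i) 2 (volume.restrict D) :=
  (EuclideanSpace.proj i : Plane →L[ℝ] ℝ).comp_memLp' hg

lemma memLp_grad_test {D : Set Plane} {φ : Plane → ℝ} (h : IsTestFunction D φ) (i : Fin 2) :
    MemLp (fun x => gradient φ x i) 2 (volume.restrict D) := by
  refine memLp_coord ?_ i
  have hc : Continuous (fderiv ℝ φ) := h.1.continuous_fderiv (by simp)
  have h2 : HasCompactSupport (gradient φ) := by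
    rw [gradient_eq]
    exact (h.2.1.fderiv (𝕜 := ℝ)).comp_left (map_zero _)
  have h1 : Continuous (gradient φ) := by
    rw [gradient_eq]
    exact (LinearIsometryEquiv.continuous _).comp hc
  exact (h1.memLp_of_hasCompactSupport h2).restrict D

/-- `H¹(D)`, as the Hilbert space of all pairs `(u, ∇u)` with `u ∈ L²(D)` and weak gradient
`∇u ∈ L²(D; ℝ²)`. The norm is `‖u‖_{H¹(D)} = (‖u‖²_{L²(D)} + ‖∇u‖²_{L²(D)})^{1/2}`. -/
def H1 (D : Set Plane) : Submodule ℝ (L2Pair D) where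
  carrier := {p | HasWeakGradient D p.fst p.snd}
  zero_mem' := by
    intro φ hφ i
    have h1 : ∀ᵐ x ∂(volume.restrict D),
        ((0 : L2Pair D).fst : Plane → ℝ) x * gradient φ x i = 0 := by
      filter_upwards [Lp.coeFn_zero ℝ 2 (volume.restrict D)] with x hx
      rw [WithLp.zero_fst, hx]; simp
    have h2 : ∀ᵐ x ∂(volume.restrict D),
        ((0 : L2Pair D).snd : Plane → Plane) x i * φ x = 0 := by
      filter_upwards [Lp.coeFn_zero Plane 2 (volume.restrict D)] with x hx
      rw [WithLp.zero_snd, hx]; simp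
    rw [integral_eq_zero_of_ae h1, integral_eq_zero_of_ae h2, neg_zero]
  add_mem' := by
    intro p q hp hq φ hφ i
    have h1 : ∀ᵐ x ∂(volume.restrict D),
        ((p + q).fst : Plane → ℝ) x * gradient φ x i =
          p.fst x * gradient φ x i + q.fst x * gradient φ x i := by
      filter_upwards [Lp.coeFn_add p.fst q.fst] with x hx
      rw [WithLp.add_fst, hx, Pi.add_apply, add_mul]
    have h2 : ∀ᵐ x ∂(volume.restrict D),
        ((p + q).snd : Plane → Plane) x i * φ x = p.snd x i * φ x + q.snd x i * φ x := by
      filter_upwards [Lp.coeFn_add p.snd q.snd] with x hx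
      rw [WithLp.add_snd, hx, Pi.add_apply, PiLp.add_apply, add_mul]
    have h3 := integral_add ((Lp.memLp p.fst).integrable_mul (memLp_grad_test hφ i))
      ((Lp.memLp q.fst).integrable_mul (memLp_grad_test hφ i))
    have h4 := integral_add
      ((memLp_coord (Lp.memLp p.snd) i).integrable_mul (memLp_test hφ))
      ((memLp_coord (Lp.memLp q.snd) i).integrable_mul (memLp_test hφ))
    simp only [Pi.mul_apply] at h3 h4
    rw [integral_congr_ae h1, integral_congr_ae h2, h3, h4, hp φ hφ i, hq φ hφ i]
    ring
  smul_mem' := by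
    intro c p hp φ hφ i
    have h1 : ∀ᵐ x ∂(volume.restrict D),
        ((c • p).fst : Plane → ℝ) x * gradient φ x i = c * (p.fst x * gradient φ x i) := by
      filter_upwards [Lp.coeFn_smul c p.fst] with x hx
      rw [WithLp.smul_fst, hx, Pi.smul_apply, smul_eq_mul, mul_assoc]
    have h2 : ∀ᵐ x ∂(volume.restrict D),
        ((c • p).snd : Plane → Plane) x i * φ x = c * (p.snd x i * φ x) := by
      filter_upwards [Lp.coeFn_smul c p.snd] with x hx
      rw [WithLp.smul_snd, hx, Pi.smul_apply, PiLp.smul_apply, smul_eq_mul, mul_assoc]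
    rw [integral_congr_ae h1, integral_congr_ae h2, integral_const_mul, integral_const_mul,
      hp φ hφ i]
    ring

/-- The function `v` underlying an element of `H¹(D)`. -/
def fn {D : Set Plane} (v : H1 D) : Lp ℝ 2 (volume.restrict D) := (v : L2Pair D).fst

/-- The weak gradient `∇v` of an element of `H¹(D)`. -/
def wgrad {D : Set Plane} (v : H1 D) : Lp Plane 2 (volume.restrict D) := (v : L2Pair D).snd

/-- The Poincaré–Wirtinger constant of `D`: the smallest `C` such that
`‖v - v̄‖_{H¹(D)} ≤ C ‖∇v‖_{L²(D)}` for all `v ∈ H¹(D)`, where `v̄` is the mean of `v` over `D`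
(and `∞` if there is no such finite `C`). -/
def poincareConst (D : Set Plane) : ℝ≥0∞ :=
  sInf {C | ∀ v : H1 D,
    eLpNorm (fun x => fn v x - ⨍ t in D, fn v t) 2 (volume.restrict D) ^ 2 + ‖wgrad v‖ₑ ^ 2
      ≤ C ^ 2 * ‖wgrad v‖ₑ ^ 2}

/-! ### The trace operator -/

/-- `g ∈ L²(S)` is the trace of `v ∈ H¹(D)` (with `S` the boundary measure): there are smooth
`φₙ : ℝ² → ℝ` with `φₙ → v` in `H¹(D)` and `φₙ → g` in `L²(S)`. -/
def IsTrace {D : Set Plane} (S : Measure Plane) (v : H1 D) (g : Lp ℝ 2 S) : Prop :=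
  ∃ φ : ℕ → Plane → ℝ, (∀ n, ContDiff ℝ (⊤ : ℕ∞) (φ n)) ∧
    Tendsto (fun n => eLpNorm (fun x => φ n x - fn v x) 2 (volume.restrict D)) atTop (𝓝 0) ∧
    Tendsto (fun n => eLpNorm (fun x => gradient (φ n) x - wgrad v x) 2 (volume.restrict D))
      atTop (𝓝 0) ∧
    Tendsto (fun n => eLpNorm (fun x => φ n x - g x) 2 S) atTop (𝓝 0)

/-- The norm of the trace operator `H¹(D) → L²(S)`: the smallest `C` such that every
`v ∈ H¹(D)` has a trace and every trace `g` of `v` satisfies `‖g‖_{L²(S)} ≤ C ‖v‖_{H¹(D)}`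
(and `∞` if there is no such finite `C`). The trace of `v` is then unique. -/
def traceConst (D : Set Plane) (S : Measure Plane) : ℝ≥0∞ :=
  sInf {C | ∀ v : H1 D, (∃ g : Lp ℝ 2 S, IsTrace S v g) ∧
    ∀ g : Lp ℝ 2 S, IsTrace S v g → ‖g‖ₑ ≤ C * ‖v‖ₑ}

open scoped Classical in
/-- The trace `v|_Γ` of `v ∈ H¹(D)`. -/
def tr {D : Set Plane} (S : Measure Plane) (v : H1 D) : Lp ℝ 2 S :=
  if h : ∃ g : Lp ℝ 2 S, IsTrace S v g then h.choose else 0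

/-! ### The quotient space `(H¹(D) ⊕ ℝ^M) / ℝ` -/

/-- `H¹(D) ⊕ ℝ^M`, with the norm `(‖v‖²_{H¹(D)} + |V|²)^{1/2}`. -/
abbrev Pre (D : Set Plane) (M : ℕ) := WithLp 2 (H1 D × EuclideanSpace ℝ (Fin M))

/-- The pairs `(c, c·𝟏)` with a constant `c`. -/
def constants (D : Set Plane) (M : ℕ) : Submodule ℝ (Pre D M) where
  carrier := {p | ∃ c : ℝ, (∀ᵐ x ∂(volume.restrict D), fn p.fst x = c) ∧ wgrad p.fst = 0 ∧
    ∀ m, p.snd m = c}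
  zero_mem' := by
    refine ⟨0, ?_, rfl, fun m => rfl⟩
    exact Lp.coeFn_zero ℝ 2 (volume.restrict D)
  add_mem' := by
    rintro p q ⟨c, hc, hc', hc''⟩ ⟨d, hd, hd', hd''⟩
    refine ⟨c + d, ?_, ?_, fun m => ?_⟩
    · filter_upwards [hc, hd, Lp.coeFn_add (fn p.fst) (fn q.fst)] with x h1 h2 h3
      rw [← h1, ← h2]; exact h3
    · exact (congrArg₂ (· + ·) hc' hd').trans (add_zero _)
    · exact congrArg₂ (· + ·) (hc'' m) (hd'' m)
  smul_mem' := by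
    rintro a p ⟨c, hc, hc', hc''⟩
    refine ⟨a * c, ?_, ?_, fun m => ?_⟩
    · filter_upwards [hc, Lp.coeFn_smul a (fn p.fst)] with x h1 h3
      rw [← h1]; exact h3
    · exact (congrArg (a • ·) hc').trans (smul_zero _)
    · exact congrArg (a * ·) (hc'' m)

/-- `(H¹(D) ⊕ ℝ^M) / ℝ` with the quotient norm
`‖(v, V)‖ = inf_c (‖v - c‖²_{H¹(D)} + |V - c·𝟏|²)^{1/2}`. -/
abbrev QuotSpace (D : Set Plane) (M : ℕ) := Pre D M ⧸ constants D M

/-- The class of `(v, V)` in the quotient space. -/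
abbrev cls {D : Set Plane} {M : ℕ} (p : Pre D M) : QuotSpace D M := (constants D M).mkQ p

/-! ### The parametrized measurement set-up -/

/-- The parameter vectors `y = (y_σ, y_γ, y_E, y_z)`. -/
structure Param (M Nσ Nγ : ℕ) where
  σ : Cube Nσ
  γ : Cube Nγ
  E : Cube M
  z : Cube M

/-- A parametrized measurement set-up with `M` electrodes. -/
structure Setup (M Nσ Nγ : ℕ) where
  /-- the period -/
  L : ℝ
  L_pos : 0 < L
  /-- the boundary curves -/
  γ : Cube Nγ → ℝ → Plane
  γ_periodic : ∀ y, Function.Periodic (γ y) L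
  γ_lipschitz : ∀ y, ∃ K : ℝ≥0, LipschitzWith K (γ y)
  γ_injOn : ∀ y, InjOn (γ y) (Ico 0 L)
  /-- the curves run counterclockwise: their winding number around enclosed points is `1` -/
  γ_counterclockwise : ∀ y, ∀ x ∈ enclosed (curveSet L (γ y)),
    windingIntegral L (γ y) x = 2 * Real.pi
  /-- `y ↦ γ(·, y)` is continuous in the norm of `C^{0,1}` -/
  γ_continuous : ∀ y₀, ∀ ε : ℝ≥0, 0 < ε → ∀ᶠ y in 𝓝 y₀,
    (∀ s, ‖γ y s - γ y₀ s‖ ≤ ε) ∧ LipschitzWith ε (fun s => γ y s - γ y₀ s)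
  /-- the bi-Lipschitz homeomorphisms `D(y) → D(0)` -/
  Φ : Cube Nγ → Plane → Plane
  Φ_bijOn : ∀ y, BijOn (Φ y) (enclosed (curveSet L (γ y)))
    (enclosed (curveSet L (γ (Cube.origin Nγ))))
  Φ_biLipschitz : ∀ y, ∃ K : ℝ, ∀ x ∈ enclosed (curveSet L (γ y)),
    ∀ x' ∈ enclosed (curveSet L (γ y)),
      dist (Φ y x) (Φ y x') ≤ K * dist x x' ∧ dist x x' ≤ K * dist (Φ y x) (Φ y x')
  /-- the width of the electrodes -/
  ω : ℝ
  ω_pos : 0 < ω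
  /-- the starting parameters of the electrodes -/
  θ : Cube M → Fin M → ℝ
  θ_mem : ∀ y m, θ y m ∈ Ico 0 L
  /-- `θ` is continuous when `L` is identified with `0` -/
  θ_continuous : ∀ m, Continuous fun y => (θ y m : AddCircle L)
  /-- the electrodes do not overlap -/
  no_overlap : ∀ j k, j ≠ k → ∀ yE yγ, ω < arcDist L (γ yγ) (θ yE j) (θ yE k)
  /-- the conductivities in the reference domain -/
  σ₀ : Cube Nσ → Lp ℝ ∞ (volume.restrict (enclosed (curveSet L (γ (Cube.origin Nγ)))))
  σ₀_continuous : Continuous σ₀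
  σ₀_pos : ∀ y, 0 < essInf (σ₀ y) (volume.restrict (enclosed (curveSet L (γ (Cube.origin Nγ)))))
  /-- the contact resistances -/
  z : Cube M → Fin M → ℝ
  z_continuous : Continuous z
  z_pos : ∀ y m, 0 < z y m

namespace Setup

variable {M Nσ Nγ : ℕ} (P : Setup M Nσ Nγ)

/-- The domain `D^y`. -/
def D (y : Param M Nσ Nγ) : Set Plane := enclosed (curveSet P.L (P.γ y.γ))

/-- The arc length measure `dS` on `Γ^y`. -/
def S (y : Param M Nσ Nγ) : Measure Plane := arcMeasure P.L (P.γ y.γ)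

/-- The electrode `E^y_m`. -/
def E (y : Param M Nσ Nγ) (m : Fin M) : Set Plane :=
  electrode P.L (P.γ y.γ) P.ω (P.θ y.E m)

/-- The conductivity `σ^y = σ₀(Φ(·, y_γ), y_σ)` in `D^y`. -/
def σ (y : Param M Nσ Nγ) (x : Plane) : ℝ := P.σ₀ y.σ (P.Φ y.γ x)

/-- `ς₋`, the minimum over `y_σ` of `ess inf σ₀(·, y_σ)`. -/
def ςmin : ℝ :=
  ⨅ y : Cube Nσ, essInf (P.σ₀ y)
    (volume.restrict (enclosed (curveSet P.L (P.γ (Cube.origin Nγ)))))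

/-- `ζ₊`, the maximum over `m` and `y_z` of `z_m(y_z)`. -/
def ζmax : ℝ := ⨆ m : Fin M, ⨆ y : Cube M, P.z y m

/-- `C_tr`, the supremum over `y` of the norms of the trace operators `H¹(D^y) → L²(Γ^y)`. -/
def Ctr : ℝ≥0∞ := ⨆ y : Param M Nσ Nγ, traceConst (P.D y) (P.S y)

/-- `C_P`, the supremum over `y` of the Poincaré–Wirtinger constants of `D^y`. -/
def CP : ℝ≥0∞ := ⨆ y : Param M Nσ Nγ, poincareConst (P.D y)

/-- The bilinear form
`B^y((w,W),(v,V)) = ∫_D σ ∇w·∇v dx + ∑ₘ zₘ⁻¹ ∫_{Eₘ} (Wₘ - w)(Vₘ - v) dS`. -/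
def B (y : Param M Nσ Nγ) (p q : Pre (P.D y) M) : ℝ :=
  (∫ x in P.D y, P.σ y x * inner ℝ (wgrad p.fst x) (wgrad q.fst x)) +
    ∑ m, (1 / P.z y.z m) * ∫ x in P.E y m,
      (p.snd m - tr (P.S y) p.fst x) * (q.snd m - tr (P.S y) q.fst x) ∂(P.S y)

/-- The variational formulation of the complete electrode model with net currents `I`. -/
def IsVariationalSolution (y : Param M Nσ Nγ) (I : EuclideanSpace ℝ (Fin M))
    (p : Pre (P.D y) M) : Prop :=
  ∀ q : Pre (P.D y) M, P.B y p q = ∑ m, I m * q.snd m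

/-- `∇·(σ^y ∇u) = 0` in `D^y`, in the sense of distributions. -/
def IsDivFree (y : Param M Nσ Nγ) (u : H1 (P.D y)) : Prop :=
  ∀ φ, IsTestFunction (P.D y) φ →
    ∫ x in P.D y, P.σ y x * inner ℝ (wgrad u x) (gradient φ x) = 0

/-- For `u` with `∇·(σ^y ∇u) = 0`: the conormal derivative `σ^y ∂u/∂ν` on `Γ^y`, defined through
Green's formula, is the function `f ∈ L²(Γ^y)`. -/
def IsConormalDerivative (y : Param M Nσ Nγ) (u : H1 (P.D y)) (f : Lp ℝ 2 (P.S y)) : Prop :=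
  ∀ v : H1 (P.D y), ∫ x in P.D y, P.σ y x * inner ℝ (wgrad u x) (wgrad v x) =
    ∫ x, f x * tr (P.S y) v x ∂(P.S y)

/-- `(u, U)` is a weak solution of the boundary value problem of the complete electrode model with
net currents `I`; here `f = σ^y ∂u/∂ν`. -/
def IsSolution (y : Param M Nσ Nγ) (I : EuclideanSpace ℝ (Fin M)) (p : Pre (P.D y) M) : Prop :=
  P.IsDivFree y p.fst ∧
  ∃ f : Lp ℝ 2 (P.S y), P.IsConormalDerivative y p.fst f ∧
    (∀ᵐ x ∂(P.S y), x ∉ closure (⋃ m, P.E y m) → f x = 0) ∧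
    (∀ m, ∀ᵐ x ∂(P.S y), x ∈ P.E y m →
      tr (P.S y) p.fst x + P.z y.z m * f x = p.snd m) ∧
    ∀ m, ∫ x in P.E y m, f x ∂(P.S y) = I m

end Setup

end CEM

end

noncomputable section

namespace CEM

/-! ### The enclosed domain -/

/-! The form `B` is bounded on `H¹(D) ⊕ ℝ^M` and vanishes when one argument is a constant pair. So
does the functional `I·V`, since the currents sum to zero. The variational problem therefore lives
on the orthogonal complement of the constants, and Lax–Milgram (`exists_orthogonal_solution`) solves
it once `B` is coercive there.

Coercivity is `norm_sq_sub_mean_le`. Let `c` be the mean of `v`. The Poincaré–Wirtinger inequality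
bounds `v - c` by the gradient. Since each electrode has length at least `ω`, `ω (Vₘ - c)²` is at
most the integral of `(Vₘ - c)²` over `Eₘ`. Writing `Vₘ - c = (Vₘ - v) + (v - c)` bounds this by
twice the residual term of `B`, up to a factor `zₘ ≤ ζ₊`, plus twice the integral of `(v - c)²`. The
electrodes are disjoint, so these last integrals add up to at most `‖tr (v - c)‖²`, hence to at most
`C_tr² C_P² ‖∇v‖²`. Collecting terms gives exactly the constant of the theorem. The stability bound
follows from `‖p‖² ≤ K B(p,p) = K I·U ≤ K |I| ‖p‖`, and uniqueness from the fact that a pair of zero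
energy is constant.

The boundary value problem is equivalent to the variational one because the Robin and zero-flux
conditions determine the conormal derivative: it is `(Uₘ - u)/zₘ` on `Eₘ` and zero elsewhere,
electrode endpoints being null. With this density `B` takes the form of Green's formula
(`B_eq_currentDensity`). The geometric input (measure, disjointness and null endpoints of
electrodes) comes from the monotone arc length function of the curve. -/

lemma isOpen_enclosed {Γ : Set Plane} (h : IsClosed Γ) : IsOpen (enclosed Γ) := by
  rw [isOpen_iff_mem_nhds]
  rintro x ⟨hx, hb⟩
  filter_upwards [(h.isOpen_compl.connectedComponentIn (x := x)).mem_nhds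
    (mem_connectedComponentIn hx)] with z hz
  exact ⟨connectedComponentIn_subset _ _ hz, connectedComponentIn_eq hz ▸ hb⟩

/-- From a point outside a ball containing `Γ`, the outward radial ray avoids `Γ`, so the component
of that point is unbounded. -/
lemma isBounded_enclosed {Γ : Set Plane} (h : Bornology.IsBounded Γ) :
    Bornology.IsBounded (enclosed Γ) := by
  obtain ⟨R, hR⟩ := h.subset_closedBall (0 : Plane)
  refine (Metric.isBounded_closedBall (x := (0 : Plane)) (r := max R 0)).subset ?_
  rintro x ⟨hx, hb⟩
  by_contra hxR
  simp only [Metric.mem_closedBall, dist_zero_right, not_le, max_lt_iff] at hxR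
  have hray : (fun t : ℝ => t • x) '' Ici 1 ⊆ connectedComponentIn Γᶜ x := by
    refine IsPreconnected.subset_connectedComponentIn
      (isPreconnected_Ici.image _ (by fun_prop)) ⟨1, self_mem_Ici, one_smul _ _⟩ ?_
    rintro _ ⟨t, ht, rfl⟩ htx
    have h1 := hR htx
    simp only [Metric.mem_closedBall, dist_zero_right, norm_smul, Real.norm_eq_abs] at h1
    have h2 : 1 ≤ |t| := le_trans ht (le_abs_self t)
    nlinarith [hxR.1, hxR.2]
  obtain ⟨K, hK⟩ := (hb.subset hray).exists_norm_le
  have h3 := hK _ ⟨max 1 (K / ‖x‖ + 1), mem_Ici.2 (le_max_left _ _), rfl⟩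
  simp only [norm_smul, Real.norm_eq_abs] at h3
  have h4 : K / ‖x‖ + 1 ≤ |max 1 (K / ‖x‖ + 1)| := (le_max_right _ _).trans (le_abs_self _)
  have h5 := mul_le_mul_of_nonneg_right h4 (norm_nonneg x)
  rw [add_mul, div_mul_cancel₀ _ hxR.2.ne'] at h5
  linarith [hxR.2]

/-! ### Smooth functions in `H¹(D)` -/

lemma memLp_of_continuous {F : Type*} [NormedAddCommGroup F] [SecondCountableTopology F]
    {D : Set Plane} (hb : Bornology.IsBounded D)
    (hm : MeasurableSet D) {f : Plane → F} (hf : Continuous f) (p : ℝ≥0∞) :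
    MemLp f p (volume.restrict D) := by
  have : IsFiniteMeasure (volume.restrict D) := ⟨by simpa using hb.measure_lt_top⟩
  obtain ⟨C, hC⟩ := (hb.isCompact_closure.image hf).isBounded.exists_norm_le
  refine MemLp.of_bound hf.aestronglyMeasurable C ?_
  filter_upwards [ae_restrict_mem hm] with x hx using hC _ ⟨x, subset_closure hx, rfl⟩

lemma continuous_gradient {φ : Plane → ℝ} (h : ContDiff ℝ (⊤ : ℕ∞) φ) :
    Continuous (gradient φ) := by
  rw [gradient_eq]
  exact (LinearIsometryEquiv.continuous _).comp (h.continuous_fderiv (by simp))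

lemma gradient_apply (φ : Plane → ℝ) (x : Plane) (i : Fin 2) :
    gradient φ x i = fderiv ℝ φ x (EuclideanSpace.single i 1) := by
  have h : inner ℝ (gradient φ x) (EuclideanSpace.single i 1) = _ := inner_gradient_left
  rw [EuclideanSpace.inner_single_right] at h
  rw [← h]
  simp

lemma gradient_add_of_contDiff {φ ψ : Plane → ℝ} (hφ : ContDiff ℝ (⊤ : ℕ∞) φ)
    (hψ : ContDiff ℝ (⊤ : ℕ∞) ψ) (x : Plane) :
    gradient (fun x => φ x + ψ x) x = gradient φ x + gradient ψ x := by
  simp only [gradient_eq]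
  rw [fderiv_fun_add (hφ.differentiable (by simp) x) (hψ.differentiable (by simp) x), map_add]

lemma gradient_const_mul_of_contDiff {φ : Plane → ℝ} (hφ : ContDiff ℝ (⊤ : ℕ∞) φ) (c : ℝ)
    (x : Plane) : gradient (fun x => c * φ x) x = c • gradient φ x := by
  simp only [gradient_eq]
  rw [fderiv_const_mul (hφ.differentiable (by simp) x), map_smul]

lemma gradient_const_fun (c : ℝ) (x : Plane) : gradient (fun _ : Plane => c) x = 0 := by
  simp

/-- The test function and its gradient vanish off `D`, so both integrals extend to the plane.
Integration by parts applies there because every product has compact support; no regularity of `D`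
enters. -/
lemma hasWeakGradient_of_contDiff {D : Set Plane} {φ : Plane → ℝ}
    (h : ContDiff ℝ (⊤ : ℕ∞) φ) : HasWeakGradient D φ (gradient φ) := by
  intro ψ hψ i
  have hψ0 : ∀ x, x ∉ D → ψ x = 0 := fun x hx =>
    image_eq_zero_of_notMem_tsupport fun h => hx (hψ.2.2 h)
  have hψ1 : ∀ x, x ∉ D → gradient ψ x = 0 := fun x hx => by
    have : fderiv ℝ ψ x = 0 := by
      have := image_eq_zero_of_notMem_tsupport (f := fderiv ℝ ψ)
        (fun h => hx (hψ.2.2 (tsupport_fderiv_subset ℝ h)))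
      exact this
    simp [gradient_eq, this]
  rw [setIntegral_eq_integral_of_forall_compl_eq_zero (fun x hx => by simp [hψ1 x hx]),
    setIntegral_eq_integral_of_forall_compl_eq_zero (fun x hx => by simp [hψ0 x hx])]
  have hcφ := h.continuous_fderiv (by simp)
  have hcψ := hψ.1.continuous_fderiv (by simp)
  have hsψ := hψ.2.1.fderiv_apply (𝕜 := ℝ) (EuclideanSpace.single i 1)
  simp only [gradient_apply]
  refine integral_mul_fderiv_eq_neg_fderiv_mul_of_integrable ?_ ?_ ?_
    (fun x _ => h.differentiable (by simp) x)
    (fun x _ => hψ.1.differentiable (by simp) x)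
  · exact ((hcφ.clm_apply continuous_const).mul hψ.1.continuous).integrable_of_hasCompactSupport
      hψ.2.1.mul_left
  · exact (h.continuous.mul (hcψ.clm_apply continuous_const)).integrable_of_hasCompactSupport
      hsψ.mul_left
  · exact (h.continuous.mul hψ.1.continuous).integrable_of_hasCompactSupport hψ.2.1.mul_left

/-- The element of `H¹(D)` given by the restriction of a smooth function to `D`. -/
def ofSmooth {D : Set Plane} (hb : Bornology.IsBounded D) (hm : MeasurableSet D) (φ : Plane → ℝ)
    (h : ContDiff ℝ (⊤ : ℕ∞) φ) : H1 D :=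
  ⟨WithLp.toLp 2 ((memLp_of_continuous hb hm h.continuous 2).toLp φ,
    (memLp_of_continuous hb hm (continuous_gradient h) 2).toLp (gradient φ)), by
    intro ψ hψ i
    have h1 := MemLp.coeFn_toLp (memLp_of_continuous hb hm h.continuous 2)
    have h2 := MemLp.coeFn_toLp (memLp_of_continuous hb hm (continuous_gradient h) 2)
    have e1 := integral_congr_ae (h1.mul (ae_eq_refl fun x => gradient ψ x i))
    have e2 := integral_congr_ae
      ((h2.fun_comp fun g : Plane => g i).mul (ae_eq_refl fun x => ψ x))
    exact e1.trans ((hasWeakGradient_of_contDiff h ψ hψ i).trans (congrArg Neg.neg e2.symm))⟩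

lemma fn_ofSmooth {D : Set Plane} (hb : Bornology.IsBounded D) (hm : MeasurableSet D)
    {φ : Plane → ℝ} (h : ContDiff ℝ (⊤ : ℕ∞) φ) :
    fn (ofSmooth hb hm φ h) =ᵐ[volume.restrict D] φ :=
  MemLp.coeFn_toLp (memLp_of_continuous hb hm h.continuous 2)

lemma wgrad_ofSmooth {D : Set Plane} (hb : Bornology.IsBounded D) (hm : MeasurableSet D)
    {φ : Plane → ℝ} (h : ContDiff ℝ (⊤ : ℕ∞) φ) :
    wgrad (ofSmooth hb hm φ h) =ᵐ[volume.restrict D] gradient φ :=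
  MemLp.coeFn_toLp (memLp_of_continuous hb hm (continuous_gradient h) 2)

/-! ### `H¹(D)` as a Hilbert space -/

lemma fn_add {D : Set Plane} (u v : H1 D) : fn (u + v) = fn u + fn v := rfl
lemma fn_sub {D : Set Plane} (u v : H1 D) : fn (u - v) = fn u - fn v := rfl
lemma fn_smul {D : Set Plane} (c : ℝ) (v : H1 D) : fn (c • v) = c • fn v := rfl
lemma wgrad_add {D : Set Plane} (u v : H1 D) : wgrad (u + v) = wgrad u + wgrad v := rfl
lemma wgrad_sub {D : Set Plane} (u v : H1 D) : wgrad (u - v) = wgrad u - wgrad v := rfl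
lemma wgrad_smul {D : Set Plane} (c : ℝ) (v : H1 D) : wgrad (c • v) = c • wgrad v := rfl

lemma norm_sq_H1 {D : Set Plane} (v : H1 D) : ‖v‖ ^ 2 = ‖fn v‖ ^ 2 + ‖wgrad v‖ ^ 2 :=
  WithLp.prod_norm_sq_eq_of_L2 (v : L2Pair D)

/-- The weak gradient as a continuous linear map. -/
def wgradL (D : Set Plane) : H1 D →L[ℝ] Lp Plane 2 (volume.restrict D) :=
  (WithLp.sndL 2 ℝ _ _).comp (H1 D).subtypeL

lemma ext_H1 {D : Set Plane} {u v : H1 D} (h1 : fn u = fn v) (h2 : wgrad u = wgrad v) : u = v := by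
  refine Subtype.ext ?_
  exact (WithLp.equiv 2 _).injective (Prod.ext h1 h2)

/-- Each weak gradient identity equates two continuous functionals of the pair, namely `L²` inner
products with a fixed test function and with its derivative. Closedness provides the completeness
needed for Lax–Milgram. -/
lemma isClosed_H1 (D : Set Plane) : IsClosed (H1 D : Set (L2Pair D)) := by
  have key : (H1 D : Set (L2Pair D)) = ⋂ (φ : {φ : Plane → ℝ // IsTestFunction D φ}), ⋂ (i : Fin 2),
      {p : L2Pair D | inner ℝ ((memLp_grad_test φ.2 i).toLp _) p.fst =
        -inner ℝ ((memLp_test φ.2).toLp _)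
          ((EuclideanSpace.proj i : Plane →L[ℝ] ℝ).compLp p.snd)} := by
    ext p
    simp only [mem_iInter, mem_ofPred_eq, Subtype.forall]
    refine forall_congr' fun φ => forall_congr' fun hφ => forall_congr' fun i => ?_
    rw [L2.inner_def, L2.inner_def]
    have e1 : ∫ x in D, inner ℝ ((memLp_grad_test hφ i).toLp _ x) (p.fst x) =
        ∫ x in D, p.fst x * gradient φ x i := by
      refine integral_congr_ae ?_
      filter_upwards [(memLp_grad_test hφ i).coeFn_toLp] with x h1
      rw [h1]
      simp
    have e2 : ∫ x in D, inner ℝ ((memLp_test hφ).toLp φ x)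
        ((EuclideanSpace.proj i : Plane →L[ℝ] ℝ).compLp p.snd x) = ∫ x in D, p.snd x i * φ x := by
      refine integral_congr_ae ?_
      filter_upwards [(memLp_test hφ).coeFn_toLp,
        (EuclideanSpace.proj i : Plane →L[ℝ] ℝ).coeFn_compLp p.snd] with x h1 h2
      rw [h1, h2]
      simp
    exact iff_of_eq (congrArg₂ (fun a b => a = -b) e1.symm e2.symm)
  rw [key]
  refine isClosed_iInter fun φ => isClosed_iInter fun i => isClosed_eq ?_ ?_
  · exact continuous_const.inner (WithLp.fstL 2 ℝ _ _).continuous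
  · exact (continuous_const.inner
      (((EuclideanSpace.proj i : Plane →L[ℝ] ℝ).compLpL 2 (volume.restrict D)).continuous.comp
        (WithLp.sndL 2 ℝ _ _).continuous)).neg

instance completeSpace_H1 (D : Set Plane) : CompleteSpace (H1 D) :=
  (isClosed_H1 D).completeSpace_coe

/-! ### Constants -/

/-- The constant function `1` in `H¹(D)`. -/
def one {D : Set Plane} (hb : Bornology.IsBounded D) (hm : MeasurableSet D) : H1 D :=
  ofSmooth hb hm (fun _ => 1) contDiff_const

lemma fn_one {D : Set Plane} (hb : Bornology.IsBounded D) (hm : MeasurableSet D) :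
    ∀ᵐ x ∂(volume.restrict D), fn (one hb hm) x = 1 :=
  fn_ofSmooth hb hm contDiff_const

lemma wgrad_one {D : Set Plane} (hb : Bornology.IsBounded D) (hm : MeasurableSet D) :
    wgrad (one hb hm) = 0 := by
  refine Lp.ext ?_
  filter_upwards [wgrad_ofSmooth hb hm (φ := fun _ => 1) contDiff_const,
    Lp.coeFn_zero Plane 2 (volume.restrict D)] with x h1 h2
  rw [h2, one, h1, gradient_const_fun, Pi.zero_apply]

/-- The pair `(1, 𝟏)`. -/
def onePair {D : Set Plane} (hb : Bornology.IsBounded D) (hm : MeasurableSet D) (M : ℕ) :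
    Pre D M :=
  WithLp.toLp 2 (one hb hm, WithLp.toLp 2 fun _ => 1)

lemma constants_eq_span {D : Set Plane} (hb : Bornology.IsBounded D) (hm : MeasurableSet D)
    (M : ℕ) : constants D M = Submodule.span ℝ {onePair hb hm M} := by
  refine le_antisymm ?_ ?_
  · rintro p ⟨c, h1, h2, h3⟩
    refine Submodule.mem_span_singleton.2 ⟨c, ?_⟩
    refine (WithLp.equiv 2 _).injective (Prod.ext (ext_H1 (Lp.ext ?_) ?_) ?_)
    · change fn (c • one hb hm) =ᵐ[_] fn p.fst
      rw [fn_smul]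
      filter_upwards [h1, fn_one hb hm, Lp.coeFn_smul c (fn (one hb hm))] with x a1 a2 a3
      rw [a3, Pi.smul_apply, a2, a1, smul_eq_mul, mul_one]
    · change wgrad (c • one hb hm) = wgrad p.fst
      rw [wgrad_smul, wgrad_one, h2, smul_zero]
    · ext m
      change c * 1 = p.snd m
      rw [h3, mul_one]
  · rw [Submodule.span_singleton_le_iff_mem]
    exact ⟨1, fn_one hb hm, wgrad_one hb hm, fun _ => rfl⟩

/-! ### Traces -/

/-- The best constant is itself admissible. Finiteness of the infimum matters when `b = 0`: it makes
`T` nonempty, while `⊤ * 0 = 0` would give no information. -/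
lemma le_sInf_mul {T : Set ℝ≥0∞} {a b : ℝ≥0∞} (hT : sInf T ≠ ⊤) (hb : b ≠ ⊤)
    (h : ∀ C ∈ T, a ≤ C * b) : a ≤ sInf T * b := by
  by_cases hb0 : b = 0
  · obtain ⟨C, hC⟩ : T.Nonempty := by
      rw [nonempty_iff_ne_empty]
      rintro rfl
      exact hT sInf_empty
    have := h C hC
    rw [hb0, mul_zero] at this ⊢
    exact this
  · rw [← ENNReal.div_le_iff hb0 hb]
    exact le_sInf fun C hC => (ENNReal.div_le_iff hb0 hb).2 (h C hC)

lemma tendsto_eLpNorm_lincomb {α F : Type*} [MeasurableSpace α] [NormedAddCommGroup F]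
    [NormedSpace ℝ F] {μ : Measure α} {f g : ℕ → α → F} {f' g' h' : α → F}
    (hf : ∀ n, AEStronglyMeasurable (f n) μ) (hg : ∀ n, AEStronglyMeasurable (g n) μ)
    (hf' : AEStronglyMeasurable f' μ) (hg' : AEStronglyMeasurable g' μ) (a b : ℝ)
    (hh : h' =ᵐ[μ] fun x => a • f' x + b • g' x)
    (h1 : Tendsto (fun n => eLpNorm (fun x => f n x - f' x) 2 μ) atTop (𝓝 0))
    (h2 : Tendsto (fun n => eLpNorm (fun x => g n x - g' x) 2 μ) atTop (𝓝 0)) :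
    Tendsto (fun n => eLpNorm (fun x => (a • f n x + b • g n x) - h' x) 2 μ) atTop (𝓝 0) := by
  have h3 := ENNReal.Tendsto.const_mul (a := ‖a‖ₑ) h1 (Or.inr enorm_ne_top)
  have h4 := ENNReal.Tendsto.const_mul (a := ‖b‖ₑ) h2 (Or.inr enorm_ne_top)
  have h5 := h3.add h4
  simp only [mul_zero, add_zero] at h5
  refine tendsto_of_tendsto_of_tendsto_of_le_of_le tendsto_const_nhds h5 (fun _ => zero_le) ?_
  intro n
  have e : (fun x => (a • f n x + b • g n x) - h' x) =ᵐ[μ]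
      (a • fun x => f n x - f' x) + (b • fun x => g n x - g' x) := by
    filter_upwards [hh] with x hx
    simp only [hx, Pi.add_apply, Pi.smul_apply, smul_sub]
    abel
  simp only
  rw [eLpNorm_congr_ae e, ← eLpNorm_const_smul, ← eLpNorm_const_smul]
  exact eLpNorm_add_le (((hf n).sub hf').const_smul a) (((hg n).sub hg').const_smul b)
    (by norm_num)

/-- Linear combinations of the approximating smooth sequences approximate the combinations in all
three norms. This yields uniqueness of the trace and linearity of `tr`. -/
lemma IsTrace.lincomb {D : Set Plane} {S : Measure Plane} {v w : H1 D} {g h : Lp ℝ 2 S}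
    (hv : IsTrace S v g) (hw : IsTrace S w h) (a b : ℝ) :
    IsTrace S (a • v + b • w) (a • g + b • h) := by
  obtain ⟨φ, h1, h2, h3, h4⟩ := hv
  obtain ⟨ψ, k1, k2, k3, k4⟩ := hw
  refine ⟨fun n x => a • φ n x + b • ψ n x,
    fun n => ((h1 n).const_smul a).add ((k1 n).const_smul b), ?_, ?_, ?_⟩
  · refine tendsto_eLpNorm_lincomb (fun n => (h1 n).continuous.aestronglyMeasurable)
      (fun n => (k1 n).continuous.aestronglyMeasurable) (Lp.aestronglyMeasurable _)
      (Lp.aestronglyMeasurable _) a b ?_ h2 k2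
    rw [fn_add, fn_smul, fn_smul]
    filter_upwards [Lp.coeFn_add (a • fn v) (b • fn w), Lp.coeFn_smul a (fn v),
      Lp.coeFn_smul b (fn w)] with x e1 e2 e3
    rw [e1, Pi.add_apply, e2, e3, Pi.smul_apply, Pi.smul_apply]
  · have e : ∀ n x, gradient (fun x => a • φ n x + b • ψ n x) x =
        a • gradient (φ n) x + b • gradient (ψ n) x := fun n x => by
      simp only [smul_eq_mul]
      rw [gradient_add_of_contDiff (contDiff_const.mul (h1 n)) (contDiff_const.mul (k1 n)),
        gradient_const_mul_of_contDiff (h1 n), gradient_const_mul_of_contDiff (k1 n)]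
    simp only [e]
    refine tendsto_eLpNorm_lincomb (fun n => (continuous_gradient (h1 n)).aestronglyMeasurable)
      (fun n => (continuous_gradient (k1 n)).aestronglyMeasurable) (Lp.aestronglyMeasurable _)
      (Lp.aestronglyMeasurable _) a b ?_ h3 k3
    rw [wgrad_add, wgrad_smul, wgrad_smul]
    filter_upwards [Lp.coeFn_add (a • wgrad v) (b • wgrad w), Lp.coeFn_smul a (wgrad v),
      Lp.coeFn_smul b (wgrad w)] with x e1 e2 e3
    rw [e1, Pi.add_apply, e2, e3, Pi.smul_apply, Pi.smul_apply]
  · refine tendsto_eLpNorm_lincomb (fun n => (h1 n).continuous.aestronglyMeasurable)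
      (fun n => (k1 n).continuous.aestronglyMeasurable) (Lp.aestronglyMeasurable _)
      (Lp.aestronglyMeasurable _) a b ?_ h4 k4
    filter_upwards [Lp.coeFn_add (a • g) (b • h), Lp.coeFn_smul a g,
      Lp.coeFn_smul b h] with x e1 e2 e3
    rw [e1, Pi.add_apply, e2, e3, Pi.smul_apply, Pi.smul_apply]

/-- Smooth functions have their restrictions as traces. -/
lemma isTrace_ofSmooth {D : Set Plane} (S : Measure Plane) (hb : Bornology.IsBounded D)
    (hm : MeasurableSet D) {φ : Plane → ℝ} (h : ContDiff ℝ (⊤ : ℕ∞) φ) {g : Lp ℝ 2 S}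
    (hg : g =ᵐ[S] φ) : IsTrace S (ofSmooth hb hm φ h) g := by
  refine ⟨fun _ => φ, fun _ => h, ?_, ?_, ?_⟩
  · refine tendsto_const_nhds.congr fun _ => ?_
    rw [eLpNorm_congr_ae (g := 0), eLpNorm_zero]
    filter_upwards [fn_ofSmooth hb hm h] with x hx
    rw [hx, sub_self, Pi.zero_apply]
  · refine tendsto_const_nhds.congr fun _ => ?_
    rw [eLpNorm_congr_ae (g := 0), eLpNorm_zero]
    filter_upwards [wgrad_ofSmooth hb hm h] with x hx
    rw [hx, sub_self, Pi.zero_apply]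
  · refine tendsto_const_nhds.congr fun _ => ?_
    rw [eLpNorm_congr_ae (g := 0), eLpNorm_zero]
    filter_upwards [hg] with x hx
    rw [hx, sub_self, Pi.zero_apply]

/-- Existence of traces is part of the condition on admissible constants: if it failed, no constant
would be admissible and the infimum would be `⊤`. -/
lemma exists_isTrace {D : Set Plane} {S : Measure Plane} (hT : traceConst D S ≠ ⊤)
    (v : H1 D) : ∃ g : Lp ℝ 2 S, IsTrace S v g := by
  by_contra hv
  refine hT ?_
  rw [traceConst, eq_empty_of_forall_notMem (s := {C : ℝ≥0∞ | _}), sInf_empty]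
  exact fun C hC => hv (hC v).1

lemma norm_le_of_isTrace {D : Set Plane} {S : Measure Plane} (hT : traceConst D S ≠ ⊤)
    {v : H1 D} {g : Lp ℝ 2 S} (h : IsTrace S v g) :
    ‖g‖ ≤ (traceConst D S).toReal * ‖v‖ := by
  have key : ‖g‖ₑ ≤ traceConst D S * ‖v‖ₑ :=
    le_sInf_mul hT enorm_ne_top fun C hC => (hC v).2 g h
  have := ENNReal.toReal_mono (ENNReal.mul_ne_top hT enorm_ne_top) key
  rwa [ENNReal.toReal_mul, toReal_enorm, toReal_enorm] at this

/-- By linearity `g - h` is a trace of `v - v = 0`, and the norm bound forces it to vanish. -/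
lemma isTrace_unique {D : Set Plane} {S : Measure Plane} (hT : traceConst D S ≠ ⊤)
    {v : H1 D} {g h : Lp ℝ 2 S} (hg : IsTrace S v g) (hh : IsTrace S v h) :
    g = h := by
  have h1 := norm_le_of_isTrace hT (hg.lincomb hh 1 (-1))
  simp only [one_smul, neg_smul, add_neg_cancel, norm_zero, mul_zero] at h1
  have h2 := norm_le_zero_iff.1 h1
  rwa [add_neg_eq_zero] at h2

lemma isTrace_tr {D : Set Plane} {S : Measure Plane} (hT : traceConst D S ≠ ⊤)
    (v : H1 D) : IsTrace S v (tr S v) := by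
  have h := exists_isTrace hT v
  rw [tr, dif_pos h]
  exact h.choose_spec

lemma tr_eq_of_isTrace {D : Set Plane} {S : Measure Plane} (hT : traceConst D S ≠ ⊤)
    {v : H1 D} {g : Lp ℝ 2 S} (h : IsTrace S v g) : tr S v = g :=
  isTrace_unique hT (isTrace_tr hT v) h

lemma norm_tr_le {D : Set Plane} {S : Measure Plane} (hT : traceConst D S ≠ ⊤)
    (v : H1 D) : ‖tr S v‖ ≤ (traceConst D S).toReal * ‖v‖ :=
  norm_le_of_isTrace hT (isTrace_tr hT v)

/-- The trace operator as a continuous linear map. -/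
def trL {D : Set Plane} {S : Measure Plane} (hT : traceConst D S ≠ ⊤) : H1 D →L[ℝ] Lp ℝ 2 S :=
  LinearMap.mkContinuous
    { toFun := tr S
      map_add' := fun v w => tr_eq_of_isTrace hT (by
        simpa using (isTrace_tr hT v).lincomb (isTrace_tr hT w) 1 1)
      map_smul' := fun c v => tr_eq_of_isTrace hT (by
        simpa using (isTrace_tr hT v).lincomb (isTrace_tr hT v) c 0) }
    (traceConst D S).toReal (norm_tr_le hT)

lemma trL_apply {D : Set Plane} {S : Measure Plane} (hT : traceConst D S ≠ ⊤) (v : H1 D) :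
    trL hT v = tr S v := rfl

lemma tr_one {D : Set Plane} {S : Measure Plane} [IsFiniteMeasure S] (hT : traceConst D S ≠ ⊤)
    (hb : Bornology.IsBounded D) (hm : MeasurableSet D) :
    tr S (one hb hm) =ᵐ[S] fun _ => 1 := by
  have h : MemLp (fun _ : Plane => (1 : ℝ)) 2 S := memLp_const 1
  rw [one, tr_eq_of_isTrace hT (isTrace_ofSmooth S hb hm contDiff_const h.coeFn_toLp)]
  exact h.coeFn_toLp

/-- A test function is its own smooth approximation, and it vanishes off `D`, where the boundary
measure lives. Hence the conormal identity contains the interior equation. -/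
lemma tr_test {D : Set Plane} {S : Measure Plane} (hT : traceConst D S ≠ ⊤)
    (hb : Bornology.IsBounded D) (hm : MeasurableSet D) (hS : ∀ᵐ x ∂S, x ∉ D) {φ : Plane → ℝ}
    (h : IsTestFunction D φ) : tr S (ofSmooth hb hm φ h.1) = 0 := by
  refine tr_eq_of_isTrace hT (isTrace_ofSmooth S hb hm h.1 ?_)
  filter_upwards [hS, Lp.coeFn_zero ℝ 2 S] with x hx h0
  rw [h0, image_eq_zero_of_notMem_tsupport fun hc => hx (h.2.2 hc), Pi.zero_apply]

/-! ### The Poincaré–Wirtinger inequality -/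

lemma enorm_sq_H1 {D : Set Plane} (v : H1 D) : ‖v‖ₑ ^ 2 = ‖fn v‖ₑ ^ 2 + ‖wgrad v‖ₑ ^ 2 := by
  have h := congrArg ENNReal.ofReal (norm_sq_H1 v)
  rwa [ENNReal.ofReal_add (sq_nonneg _) (sq_nonneg _), ENNReal.ofReal_pow (norm_nonneg _),
    ENNReal.ofReal_pow (norm_nonneg _), ENNReal.ofReal_pow (norm_nonneg _), ofReal_norm,
    ofReal_norm, ofReal_norm] at h

lemma poincare_le {D : Set Plane} (hP : poincareConst D ≠ ⊤) (hb : Bornology.IsBounded D)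
    (hm : MeasurableSet D) (v : H1 D) :
    ‖v - (⨍ t in D, fn v t) • one hb hm‖ ≤ (poincareConst D).toReal * ‖wgrad v‖ := by
  set c := ⨍ t in D, fn v t with hc
  have h1 : eLpNorm (fun x => fn v x - c) 2 (volume.restrict D) = ‖fn (v - c • one hb hm)‖ₑ := by
    rw [Lp.enorm_def, fn_sub, fn_smul]
    refine eLpNorm_congr_ae ?_
    filter_upwards [Lp.coeFn_sub (fn v) (c • fn (one hb hm)), Lp.coeFn_smul c (fn (one hb hm)),
      fn_one hb hm] with x e1 e2 e3
    rw [e1, Pi.sub_apply, e2, Pi.smul_apply, e3, smul_eq_mul, mul_one]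
  have h2 : wgrad (v - c • one hb hm) = wgrad v := by
    rw [wgrad_sub, wgrad_smul, wgrad_one, smul_zero, sub_zero]
  have h3 : ‖v - c • one hb hm‖ₑ ^ 2 =
      eLpNorm (fun x => fn v x - c) 2 (volume.restrict D) ^ 2 + ‖wgrad v‖ₑ ^ 2 := by
    rw [h1, ← h2]
    exact enorm_sq_H1 _
  have h4 : ∀ C ∈ {C : ℝ≥0∞ | ∀ v : H1 D,
      eLpNorm (fun x => fn v x - ⨍ t in D, fn v t) 2 (volume.restrict D) ^ 2 + ‖wgrad v‖ₑ ^ 2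
      ≤ C ^ 2 * ‖wgrad v‖ₑ ^ 2}, ‖v - c • one hb hm‖ₑ ≤ C * ‖wgrad v‖ₑ := by
    intro C hC
    have := hC v
    rwa [← hc, ← h3, ← mul_pow, ENNReal.pow_le_pow_left_iff two_ne_zero] at this
  have key : ‖v - c • one hb hm‖ₑ ≤ poincareConst D * ‖wgrad v‖ₑ :=
    le_sInf_mul hP enorm_ne_top h4
  have := ENNReal.toReal_mono (ENNReal.mul_ne_top hP enorm_ne_top) key
  rwa [ENNReal.toReal_mul, toReal_enorm, toReal_enorm] at this

/-! ### Arc length -/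

/-- Lipschitz parametrizations, of period `L`, of closed curves without self-intersections. -/
structure IsClosedCurve (L : ℝ) (γ : ℝ → Plane) : Prop where
  pos : 0 < L
  periodic : Function.Periodic γ L
  lipschitz : ∃ K : ℝ≥0, LipschitzWith K γ
  injOn : InjOn γ (Ico 0 L)

namespace IsClosedCurve

variable {L : ℝ} {γ : ℝ → Plane}

lemma continuous (h : IsClosedCurve L γ) : Continuous γ := by
  obtain ⟨K, hK⟩ := h.lipschitz
  exact hK.continuous

lemma deriv_periodic (h : IsClosedCurve L γ) : Function.Periodic (deriv γ) L := by
  intro s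
  rw [← deriv_comp_add_const]
  exact congrFun (congrArg deriv (funext h.periodic)) s

lemma intervalIntegrable (h : IsClosedCurve L γ) (a b : ℝ) :
    IntervalIntegrable (fun s => ‖deriv γ s‖) volume a b := by
  obtain ⟨K, hK⟩ := h.lipschitz
  refine (intervalIntegrable_const (c := (K : ℝ))).mono_fun
    (measurable_deriv γ).norm.aestronglyMeasurable (Eventually.of_forall fun s => ?_)
  simp only [norm_norm]
  exact (norm_deriv_le_of_lipschitz hK).trans (le_abs_self _)

/-- An electrode may run past the parameter `L`, so it is described in a window starting at its own
initial parameter. Points beyond `L` are moved back by one period. -/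
lemma injOn_shift (h : IsClosedCurve L γ) {θ : ℝ} (hθ : θ ∈ Ico 0 L) :
    InjOn γ (Ico θ (θ + L)) := by
  have hp : ∀ s, γ (s - L) = γ s := fun s => h.periodic.sub_eq s
  have key : ∀ s ∈ Ico θ (θ + L), ∀ t ∈ Ico θ (θ + L), γ s = γ t → s < L → L ≤ t → False := by
    intro s hs t ht hst h1 h2
    rw [← hp t] at hst
    have := h.injOn ⟨hθ.1.trans hs.1, h1⟩ ⟨sub_nonneg.2 h2, by linarith [ht.2, hθ.2]⟩ hst
    linarith [hs.1, ht.2]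
  intro s hs t ht hst
  rcases lt_or_ge s L with h1 | h1 <;> rcases lt_or_ge t L with h2 | h2
  · exact h.injOn ⟨hθ.1.trans hs.1, h1⟩ ⟨hθ.1.trans ht.1, h2⟩ hst
  · exact (key s hs t ht hst h1 h2).elim
  · exact (key t ht s hs hst.symm h2 h1).elim
  · rw [← hp s, ← hp t] at hst
    have := h.injOn ⟨sub_nonneg.2 h1, by linarith [hs.2, hθ.2]⟩
      ⟨sub_nonneg.2 h2, by linarith [ht.2, hθ.2]⟩ hst
    linarith

/-- The integrand is `L`-periodic, and any two half-open windows of length `L` are fundamental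
domains for translation by `L`. -/
lemma arcMeasure_apply (h : IsClosedCurve L γ) (θ : ℝ) {A : Set Plane} (hA : MeasurableSet A) :
    arcMeasure L γ A = ∫⁻ s in γ ⁻¹' A ∩ Ico θ (θ + L), ‖deriv γ s‖ₑ := by
  have hm : MeasurableSet (γ ⁻¹' A) := h.continuous.measurable hA
  have hper : ∀ (g : AddSubgroup.zmultiples L) (x : ℝ),
      (γ ⁻¹' A).indicator (fun s => ‖deriv γ s‖ₑ) (g +ᵥ x) =
        (γ ⁻¹' A).indicator (fun s => ‖deriv γ s‖ₑ) x := by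
    rintro ⟨_, n, rfl⟩ x
    change (γ ⁻¹' A).indicator (fun s => ‖deriv γ s‖ₑ) (n • L + x) = _
    have h1 : γ (n • L + x) = γ x := by
      rw [add_comm]; exact h.periodic.zsmul n x
    have h2 : deriv γ (n • L + x) = deriv γ x := by
      rw [add_comm]; exact h.deriv_periodic.zsmul n x
    by_cases hx : γ x ∈ A
    · rw [indicator_of_mem (by rwa [mem_preimage, h1]), indicator_of_mem (s := γ ⁻¹' A) hx, h2]
    · rw [indicator_of_notMem (by rwa [mem_preimage, h1]), indicator_of_notMem (s := γ ⁻¹' A) hx]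
  have hshift : ∫⁻ s in Ico 0 L, (γ ⁻¹' A).indicator (fun s => ‖deriv γ s‖ₑ) s =
      ∫⁻ s in Ico θ (θ + L), (γ ⁻¹' A).indicator (fun s => ‖deriv γ s‖ₑ) s := by
    rw [setLIntegral_congr Ico_ae_eq_Ioc, setLIntegral_congr (s := Ico θ _) Ico_ae_eq_Ioc]
    have h0 := isAddFundamentalDomain_Ioc h.pos 0
    rw [zero_add] at h0
    exact h0.setLIntegral_eq (isAddFundamentalDomain_Ioc h.pos θ) _ hper
  rw [arcMeasure, Measure.map_apply h.continuous.measurable hA, withDensity_apply _ hm,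
    ← lintegral_indicator hm, hshift, lintegral_indicator hm, Measure.restrict_restrict hm]

lemma arcMeasure_image (h : IsClosedCurve L γ) {θ : ℝ} (hθ : θ ∈ Ico 0 L) {N : Set ℝ}
    (hN : MeasurableSet N) (hs : N ⊆ Ico θ (θ + L)) :
    arcMeasure L γ (γ '' N) = ∫⁻ s in N, ‖deriv γ s‖ₑ := by
  have hi := h.injOn_shift hθ
  rw [h.arcMeasure_apply θ (hN.image_of_continuousOn_injOn h.continuous.continuousOn (hi.mono hs))]
  congr 2
  ext s
  refine ⟨?_, fun hx => ⟨mem_image_of_mem _ hx, hs hx⟩⟩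
  rintro ⟨⟨t, ht, hts⟩, hx⟩
  exact hi (hs ht) hx hts ▸ ht

lemma isFiniteMeasure (h : IsClosedCurve L γ) : IsFiniteMeasure (arcMeasure L γ) := by
  obtain ⟨K, hK⟩ := h.lipschitz
  constructor
  rw [h.arcMeasure_apply 0 MeasurableSet.univ, preimage_univ, univ_inter]
  refine (setLIntegral_mono_ae (g := fun _ => (K : ℝ≥0∞)) aemeasurable_const
    (Eventually.of_forall fun s _ => ?_)).trans_lt ?_
  · rw [enorm_le_coe, ← NNReal.coe_le_coe, coe_nnnorm]
    exact norm_deriv_le_of_lipschitz hK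
  · rw [setLIntegral_const]
    exact ENNReal.mul_lt_top ENNReal.coe_lt_top (by simp)

lemma isCompact_curveSet (h : IsClosedCurve L γ) : IsCompact (curveSet L γ) := by
  have : curveSet L γ = γ '' Icc 0 L := by
    refine Subset.antisymm (image_mono Ico_subset_Icc_self) ?_
    rintro _ ⟨s, hs, rfl⟩
    rcases hs.2.lt_or_eq with h1 | h1
    · exact ⟨s, ⟨hs.1, h1⟩, rfl⟩
    · refine ⟨0, ⟨le_rfl, h.pos⟩, ?_⟩
      rw [h1, ← h.periodic 0, zero_add]
  rw [this]
  exact isCompact_Icc.image h.continuous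

lemma ae_mem_curveSet (h : IsClosedCurve L γ) : ∀ᵐ x ∂(arcMeasure L γ), x ∈ curveSet L γ := by
  have : arcMeasure L γ (curveSet L γ)ᶜ = 0 := by
    rw [h.arcMeasure_apply 0 h.isCompact_curveSet.measurableSet.compl]
    convert setLIntegral_empty _
    rw [← disjoint_iff_inter_eq_empty, disjoint_left]
    intro s hs hs'
    rw [zero_add] at hs'
    exact hs (mem_image_of_mem _ hs')
  exact this

/-! ### Electrodes -/

lemma continuous_arc (h : IsClosedCurve L γ) (θ : ℝ) :
    Continuous fun t => ∫ s in θ..t, ‖deriv γ s‖ :=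
  intervalIntegral.continuous_primitive h.intervalIntegrable θ

lemma arc_sub (h : IsClosedCurve L γ) (θ a b : ℝ) :
    (∫ s in θ..b, ‖deriv γ s‖) - ∫ s in θ..a, ‖deriv γ s‖ = ∫ s in a..b, ‖deriv γ s‖ :=
  intervalIntegral.integral_interval_sub_left (h.intervalIntegrable _ _) (h.intervalIntegrable _ _)

lemma monotone_arc (h : IsClosedCurve L γ) (θ : ℝ) :
    Monotone fun t => ∫ s in θ..t, ‖deriv γ s‖ := by
  intro a b hab
  rw [← sub_nonneg]
  simp only
  rw [h.arc_sub]
  exact intervalIntegral.integral_nonneg hab fun _ _ => norm_nonneg _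

lemma setLIntegral_Icc_speed (h : IsClosedCurve L γ) {a b : ℝ} (hab : a ≤ b) :
    ∫⁻ s in Icc a b, ‖deriv γ s‖ₑ = ENNReal.ofReal (∫ s in a..b, ‖deriv γ s‖) := by
  rw [setLIntegral_congr Ioc_ae_eq_Icc.symm, intervalIntegral.integral_of_le hab,
    ofReal_integral_eq_lintegral_ofReal (h.intervalIntegrable a b).1
      (Eventually.of_forall fun _ => norm_nonneg _)]
  simp only [ofReal_norm]

/-- A nonempty level set of the monotone arc length function contains its least and greatest points,
and no length accumulates between them. Thus the electrode endpoints are null for `|γ'| ds`, without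
any lower bound on the speed. -/
lemma setLIntegral_level (h : IsClosedCurve L γ) (θ c a b : ℝ) :
    ∫⁻ s in {t ∈ Icc a b | ∫ s in θ..t, ‖deriv γ s‖ = c}, ‖deriv γ s‖ₑ = 0 := by
  set Z := {t ∈ Icc a b | ∫ s in θ..t, ‖deriv γ s‖ = c} with hZ
  rcases Z.eq_empty_or_nonempty with he | hne
  · rw [he, setLIntegral_empty]
  have hc : IsCompact Z := isCompact_Icc.inter_right
    (isClosed_eq (h.continuous_arc θ) continuous_const)
  obtain ⟨p, hp⟩ := hc.exists_isLeast hne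
  obtain ⟨q, hq⟩ := hc.exists_isGreatest hne
  have hsub : Z ⊆ Icc p q := fun t ht => ⟨hp.2 ht, hq.2 ht⟩
  refine le_antisymm ((lintegral_mono_set hsub).trans ?_) zero_le
  rw [h.setLIntegral_Icc_speed (hp.2 hq.1), ← h.arc_sub θ, hp.1.2, hq.1.2, sub_self,
    ENNReal.ofReal_zero]

/-- Replacing a parameter `φ < θ` by `φ + L` removes the case distinction in `arcDist`. -/
lemma electrode_eq (h : IsClosedCurve L γ) {θ : ℝ} (hθ : θ ∈ Ico 0 L) (ω : ℝ) :
    electrode L γ ω θ = γ '' {t ∈ Ico θ (θ + L) |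
      0 < (∫ s in θ..t, ‖deriv γ s‖) ∧ (∫ s in θ..t, ‖deriv γ s‖) < ω} := by
  ext x
  constructor
  · rintro ⟨φ, hφ, rfl, h1, h2⟩
    rw [arcDist] at h1 h2
    split_ifs at h1 h2 with hle
    · exact ⟨φ, ⟨⟨hle, by linarith [hφ.2, hθ.1]⟩, h1, h2⟩, rfl⟩
    · exact ⟨φ + L, ⟨⟨by linarith [hφ.1, hθ.2], by linarith⟩, h1, h2⟩, h.periodic φ⟩
  · rintro ⟨t, ⟨ht, h1, h2⟩, rfl⟩
    rcases lt_or_ge t L with hlt | hge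
    · refine ⟨t, ⟨hθ.1.trans ht.1, hlt⟩, rfl, ?_⟩
      rw [arcDist, if_pos ht.1]
      exact ⟨h1, h2⟩
    · refine ⟨t - L, ⟨sub_nonneg.2 hge, by linarith [ht.2, hθ.2]⟩, (h.periodic.sub_eq t).symm, ?_⟩
      rw [arcDist, if_neg (by linarith [ht.2]), sub_add_cancel]
      exact ⟨h1, h2⟩

lemma measurableSet_arc (h : IsClosedCurve L γ) (θ ω : ℝ) :
    MeasurableSet {t ∈ Ico θ (θ + L) |
      0 < (∫ s in θ..t, ‖deriv γ s‖) ∧ (∫ s in θ..t, ‖deriv γ s‖) < ω} :=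
  measurableSet_Ico.inter ((measurableSet_lt measurable_const (h.continuous_arc θ).measurable).inter
    (measurableSet_lt (h.continuous_arc θ).measurable measurable_const))

lemma measurableSet_electrode (h : IsClosedCurve L γ) {θ : ℝ} (hθ : θ ∈ Ico 0 L) (ω : ℝ) :
    MeasurableSet (electrode L γ ω θ) := by
  rw [h.electrode_eq hθ]
  exact (h.measurableSet_arc θ ω).image_of_continuousOn_injOn h.continuous.continuousOn
    ((h.injOn_shift hθ).mono fun t ht => ht.1)

/-- The intermediate value theorem gives `b` at arc length `ω` from `θ`. The interval `[θ, b]`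
carries length `ω` and exceeds the electrode's parameter set only by points of the levels `0` and
`ω`, which are null. -/
lemma le_arcMeasure_electrode (h : IsClosedCurve L γ) {θ : ℝ} (hθ : θ ∈ Ico 0 L) {ω : ℝ}
    (hω : 0 < ω) (hlen : ω < ∫ s in θ..θ + L, ‖deriv γ s‖) :
    ENNReal.ofReal ω ≤ arcMeasure L γ (electrode L γ ω θ) := by
  obtain ⟨b, hb, hbω⟩ := intermediate_value_Icc (le_add_of_nonneg_right h.pos.le)
    (h.continuous_arc θ).continuousOn
    (show ω ∈ Icc (∫ s in θ..θ, ‖deriv γ s‖) (∫ s in θ..θ + L, ‖deriv γ s‖) from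
      ⟨by rw [intervalIntegral.integral_same]; exact hω.le, hlen.le⟩)
  simp only at hbω
  have hbL : b < θ + L := lt_of_le_of_ne hb.2 fun he => by
    rw [he] at hbω
    exact hlen.ne' hbω
  rw [h.electrode_eq hθ, h.arcMeasure_image hθ (h.measurableSet_arc θ ω) fun t ht => ht.1]
  set A := {t ∈ Ico θ (θ + L) |
      0 < (∫ s in θ..t, ‖deriv γ s‖) ∧ (∫ s in θ..t, ‖deriv γ s‖) < ω}
  have hsub : Icc θ b ⊆ (A ∪ {t ∈ Icc θ b | ∫ s in θ..t, ‖deriv γ s‖ = 0}) ∪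
      {t ∈ Icc θ b | ∫ s in θ..t, ‖deriv γ s‖ = ω} := by
    intro t ht
    have h0 := h.monotone_arc θ ht.1
    have h1 := h.monotone_arc θ ht.2
    simp only [intervalIntegral.integral_same, hbω] at h0 h1
    rcases h0.eq_or_lt with h2 | h2
    · exact Or.inl (Or.inr ⟨ht, h2.symm⟩)
    rcases h1.eq_or_lt with h3 | h3
    · exact Or.inr ⟨ht, h3⟩
    · exact Or.inl (Or.inl ⟨⟨ht.1, ht.2.trans_lt hbL⟩, h2, h3⟩)
  calc ENNReal.ofReal ω = ∫⁻ s in Icc θ b, ‖deriv γ s‖ₑ := by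
        rw [h.setLIntegral_Icc_speed hb.1, hbω]
    _ ≤ _ := lintegral_mono_set hsub
    _ ≤ _ := lintegral_union_le _ _ _
    _ ≤ _ := add_le_add_left (lintegral_union_le _ _ _) _
    _ = _ := by rw [h.setLIntegral_level, h.setLIntegral_level, add_zero, add_zero]

/-- The closure lies in the compact image of `{0 ≤ arc length ≤ ω}`, so it adds only the null levels
`0` and `ω`; `hlen` keeps the end of the window out. This reconciles zero flux off the closed
electrodes with a density supported on the open ones. -/
lemma ae_closure_electrode (h : IsClosedCurve L γ) {θ : ℝ} (hθ : θ ∈ Ico 0 L) {ω : ℝ}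
    (hlen : ω < ∫ s in θ..θ + L, ‖deriv γ s‖) :
    ∀ᵐ x ∂(arcMeasure L γ), x ∈ closure (electrode L γ ω θ) → x ∈ electrode L γ ω θ := by
  have hnull : ∀ c, arcMeasure L γ
      (γ '' {t ∈ Ico θ (θ + L) | ∫ s in θ..t, ‖deriv γ s‖ = c}) = 0 := by
    intro c
    have hm : MeasurableSet {t ∈ Ico θ (θ + L) | ∫ s in θ..t, ‖deriv γ s‖ = c} :=
      measurableSet_Ico.inter (measurableSet_eq_fun (h.continuous_arc θ).measurable
        measurable_const)
    rw [h.arcMeasure_image hθ hm fun t ht => ht.1]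
    refine le_antisymm ((lintegral_mono_set ?_).trans (h.setLIntegral_level θ c θ (θ + L)).le)
      zero_le
    exact fun t ht => ⟨Ico_subset_Icc_self ht.1, ht.2⟩
  have hcl : closure (electrode L γ ω θ) ⊆ γ '' {t ∈ Icc θ (θ + L) |
      (∫ s in θ..t, ‖deriv γ s‖) ∈ Icc 0 ω} := by
    refine closure_minimal ?_ (IsCompact.isClosed ?_)
    · rw [h.electrode_eq hθ]
      exact image_mono fun t ht => ⟨Ico_subset_Icc_self ht.1, ht.2.1.le, ht.2.2.le⟩
    · exact (isCompact_Icc.inter_right (isClosed_Icc.preimage (h.continuous_arc θ))).image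
        h.continuous
  have h0 := compl_mem_ae_iff.2 (hnull 0)
  have hω := compl_mem_ae_iff.2 (hnull ω)
  filter_upwards [h0, hω] with x hx0 hxω hx
  obtain ⟨t, ⟨ht, h1, h2⟩, rfl⟩ := hcl hx
  have htL : t < θ + L := lt_of_le_of_ne ht.2 fun he => by
    rw [he] at h2
    exact hlen.not_ge h2
  rw [h.electrode_eq hθ]
  refine ⟨t, ⟨⟨ht.1, htL⟩, lt_of_le_of_ne h1 fun he => ?_, lt_of_le_of_ne h2 fun he => ?_⟩, rfl⟩
  · exact hx0 ⟨t, ⟨⟨ht.1, htL⟩, he.symm⟩, rfl⟩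
  · exact hxω ⟨t, ⟨⟨ht.1, htL⟩, he⟩, rfl⟩

lemma arcDist_le_length (h : IsClosedCurve L γ) {θ φ : ℝ} (hθ : θ ∈ Ico 0 L) (hφ : φ ∈ Ico 0 L) :
    arcDist L γ θ φ ≤ ∫ s in θ..θ + L, ‖deriv γ s‖ := by
  rw [arcDist]
  refine h.monotone_arc θ ?_
  split_ifs with hle
  · linarith [hφ.2, hθ.1]
  · linarith

/-- Expressing every arc distance through one primitive based at `0` turns statements about the
cyclic order into linear arithmetic. -/
lemma arcDist_eq (h : IsClosedCurve L γ) (a b : ℝ) :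
    arcDist L γ a b = (∫ s in (0 : ℝ)..b, ‖deriv γ s‖) - (∫ s in (0 : ℝ)..a, ‖deriv γ s‖) +
      if a ≤ b then 0 else ∫ s in (0 : ℝ)..L, ‖deriv γ s‖ := by
  rw [arcDist, ← h.arc_sub 0]
  split_ifs with hab
  · rw [add_zero]
  · have h1 : Function.Periodic (fun s => ‖deriv γ s‖) L := fun s => by
      simp only [h.deriv_periodic s]
    have h2 := h1.intervalIntegral_add_eq b 0
    rw [← h.arc_sub 0, zero_add] at h2
    linarith

/-- Walking backwards from a common point, both starting points are met within distance `ω`. The one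
met first is then within `ω` of the other in the counterclockwise direction, contrary to the
separation. -/
lemma disjoint_electrode (h : IsClosedCurve L γ) {θ θ' ω : ℝ} (hθ : θ ∈ Ico 0 L)
    (hθ' : θ' ∈ Ico 0 L) (h1 : ω < arcDist L γ θ θ') (h2 : ω < arcDist L γ θ' θ) :
    Disjoint (electrode L γ ω θ) (electrode L γ ω θ') := by
  rw [disjoint_left]
  rintro x ⟨φ, hφ, rfl, h3, h4⟩ ⟨φ', hφ', he, h5, h6⟩
  obtain rfl := h.injOn hφ hφ' he
  have mono : ∀ {a b : ℝ}, a ≤ b →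
      (∫ s in (0 : ℝ)..a, ‖deriv γ s‖) ≤ ∫ s in (0 : ℝ)..b, ‖deriv γ s‖ :=
    fun hab => h.monotone_arc 0 hab
  have e0 : (∫ s in (0 : ℝ)..0, ‖deriv γ s‖) = 0 := intervalIntegral.integral_same
  have a1 := mono hθ.1
  have a2 := mono hθ.2.le
  have b1 := mono hθ'.1
  have b2 := mono hθ'.2.le
  have c1 := mono hφ.1
  have c2 := mono hφ.2.le
  rw [h.arcDist_eq] at h1 h2 h3 h4 h5 h6
  -- These link the parameter order in the case distinctions to the order of the arc lengths;
  -- afterwards the integrals can be treated as plain numbers.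
  have d1 := @mono θ θ'
  have d2 := @mono θ' θ
  have d3 := @mono θ φ
  have d4 := @mono φ θ
  have d5 := @mono θ' φ
  have d6 := @mono φ θ'
  clear mono
  generalize (∫ s in (0 : ℝ)..θ, ‖deriv γ s‖) = x at *
  generalize (∫ s in (0 : ℝ)..θ', ‖deriv γ s‖) = x' at *
  generalize (∫ s in (0 : ℝ)..φ, ‖deriv γ s‖) = z at *
  generalize (∫ s in (0 : ℝ)..L, ‖deriv γ s‖) = ℓ at *
  clear hθ hθ' hφ hφ'
  grind

end IsClosedCurve

/-! ### Essential bounds and bi-Lipschitz maps -/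

lemma ae_abs_le_norm {α : Type*} [MeasurableSpace α] {μ : Measure α} (f : Lp ℝ ∞ μ) :
    ∀ᵐ x ∂μ, |f x| ≤ ‖f‖ := by
  filter_upwards [enorm_ae_le_eLpNormEssSup f μ] with x hx
  have h := Lp.enorm_def f
  rw [eLpNorm_exponent_top] at h
  rw [← h] at hx
  have := ENNReal.toReal_mono enorm_ne_top hx
  rwa [toReal_enorm, toReal_enorm] at this

lemma ae_essInf_le_Linfty {α : Type*} [MeasurableSpace α] {μ : Measure α} (f : Lp ℝ ∞ μ) :
    ∀ᵐ x ∂μ, essInf f μ ≤ f x := by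
  refine ae_essInf_le ?_
  refine isBoundedUnder_of_eventually_ge (a := -‖f‖) ?_
  filter_upwards [ae_abs_le_norm f] with x hx using (abs_le.1 hx).1

/-- Every real is an a.e. lower bound for the zero measure, and the supremum of an unbounded set of
reals is `0` by convention. Positivity of the essential infimum therefore excludes a null reference
domain. -/
lemma essInf_measure_zero_real {α : Type*} [MeasurableSpace α] (f : α → ℝ) :
    essInf f (0 : Measure α) = 0 := by
  rw [essInf_eq_sSup]
  refine Real.sSup_of_not_bddAbove ?_
  rintro ⟨b, hb⟩
  have : b + 1 ≤ b := hb (show (0 : Measure α) _ = 0 from rfl)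
  linarith

/-- Half of the 1-Lipschitz estimate for `essInf`. A nonzero measure is needed for the a.e. upper
bound on `f` to bound the set of its lower bounds. -/
lemma essInf_sub_le {α : Type*} [MeasurableSpace α] {μ : Measure α} [NeZero μ] (f g : Lp ℝ ∞ μ) :
    essInf g μ - ‖f - g‖ ≤ essInf f μ := by
  have : (ae μ).NeBot := ae_neBot.2 (NeZero.ne μ)
  refine le_liminf_of_le ?_ ?_
  · refine IsBoundedUnder.isCoboundedUnder_ge ?_
    refine isBoundedUnder_of_eventually_le (a := ‖f‖) ?_
    filter_upwards [ae_abs_le_norm f] with x hx using (abs_le.1 hx).2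
  · filter_upwards [ae_essInf_le_Linfty g, ae_abs_le_norm (f - g), Lp.coeFn_sub f g] with x h1 h2 h3
    rw [h3, Pi.sub_apply] at h2
    linarith [(abs_le.1 h2).1]

lemma continuous_essInf_Linfty {α : Type*} [MeasurableSpace α] {μ : Measure α} [NeZero μ] :
    Continuous fun f : Lp ℝ ∞ μ => essInf f μ := by
  refine (LipschitzWith.of_dist_le_mul (K := 1) fun f g => ?_).continuous
  rw [NNReal.coe_one, one_mul, Real.dist_eq, dist_eq_norm f g, abs_le]
  have h1 := essInf_sub_le f g
  have h2 := essInf_sub_le g f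
  rw [norm_sub_rev] at h2
  constructor <;> linarith

/-- Lebesgue measure and two-dimensional Hausdorff measure have the same null sets, and Lipschitz
maps preserve null sets of the latter. -/
lemma volume_image_eq_zero_of_lipschitzOn {K : ℝ≥0} {f : Plane → Plane} {s : Set Plane}
    (hf : LipschitzOnWith K f s) (hs : volume s = 0) : volume (f '' s) = 0 := by
  have h1 : (Measure.hausdorffMeasure (2 : ℕ) : Measure Plane) ≪ volume :=
    Measure.absolutelyContinuous_isAddHaarMeasure _ _
  have h2 : (volume : Measure Plane) ≪ Measure.hausdorffMeasure (2 : ℕ) :=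
    Measure.absolutelyContinuous_isAddHaarMeasure _ _
  refine h2 (le_antisymm ?_ zero_le)
  refine (hf.hausdorffMeasure_image_le (by positivity)).trans ?_
  rw [h1 hs, mul_zero]

/-- The exceptional set in `D` is the image of a null set under the Lipschitz inverse of `Φ`. Hence
a.e. bounds on `σ₀` pass to `σ^y`. -/
lemma ae_comp_of_antilipschitz {D D' : Set Plane} {Φ : Plane → Plane}
    (hD : MeasurableSet D) (hD' : MeasurableSet D') (hΦ : MapsTo Φ D D') {K : ℝ}
    (hK : ∀ x ∈ D, ∀ x' ∈ D, dist x x' ≤ K * dist (Φ x) (Φ x'))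
    {p : Plane → Prop} (hp : ∀ᵐ x ∂(volume.restrict D'), p x) :
    ∀ᵐ x ∂(volume.restrict D), p (Φ x) := by
  rw [ae_restrict_iff' hD'] at hp
  rw [ae_restrict_iff' hD]
  have hinj : InjOn Φ D := fun x hx x' hx' h => by
    have := hK x hx x' hx'
    rw [h, dist_self, mul_zero] at this
    exact dist_le_zero.1 this
  set N : Set Plane := Φ '' {x ∈ D | ¬ p (Φ x)} with hN
  have hN0 : volume N = 0 := by
    refine measure_mono_null ?_ hp
    rintro _ ⟨x, ⟨hx, hpx⟩, rfl⟩ h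
    exact hpx (h (hΦ hx))
  have hinv : ∀ x ∈ D, Function.invFunOn Φ D (Φ x) = x := fun x hx => hinj.leftInvOn_invFunOn hx
  have hlip : LipschitzOnWith K.toNNReal (Function.invFunOn Φ D) N := by
    refine LipschitzOnWith.of_dist_le_mul ?_
    rintro _ ⟨x, ⟨hx, -⟩, rfl⟩ _ ⟨x', ⟨hx', -⟩, rfl⟩
    rw [hinv x hx, hinv x' hx']
    exact (hK x hx x' hx').trans (mul_le_mul_of_nonneg_right (le_max_left _ _) dist_nonneg)
  refine measure_mono_null ?_ (volume_image_eq_zero_of_lipschitzOn hlip hN0)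
  intro x hx
  simp only [mem_compl_iff, mem_ofPred_eq, Classical.not_imp] at hx
  exact ⟨Φ x, ⟨x, hx, rfl⟩, hinv x hx.1⟩

/-! ### Uniform bounds on conductivity and contact resistances -/

namespace Setup

variable {M Nσ Nγ : ℕ} (P : Setup M Nσ Nγ)

lemma isClosedCurve (y : Cube Nγ) : IsClosedCurve P.L (P.γ y) :=
  ⟨P.L_pos, P.γ_periodic y, P.γ_lipschitz y, P.γ_injOn y⟩

lemma isOpen_domain (y : Cube Nγ) : IsOpen (enclosed (curveSet P.L (P.γ y))) :=
  isOpen_enclosed (P.isClosedCurve y).isCompact_curveSet.isClosed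

lemma isBounded_D (y : Param M Nσ Nγ) : Bornology.IsBounded (P.D y) :=
  isBounded_enclosed (P.isClosedCurve y.γ).isCompact_curveSet.isBounded

lemma measurableSet_D (y : Param M Nσ Nγ) : MeasurableSet (P.D y) :=
  (P.isOpen_domain y.γ).measurableSet

lemma aestronglyMeasurable_σ (y : Param M Nσ Nγ) :
    AEStronglyMeasurable (P.σ y) (volume.restrict (P.D y)) := by
  obtain ⟨K, hK⟩ := P.Φ_biLipschitz y.γ
  have hc : ContinuousOn (P.Φ y.γ) (P.D y) := by
    refine (LipschitzOnWith.of_dist_le_mul (K := K.toNNReal) fun x hx x' hx' => ?_).continuousOn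
    exact (hK x hx x' hx').1.trans (mul_le_mul_of_nonneg_right (le_max_left _ _) dist_nonneg)
  exact ((Lp.stronglyMeasurable (P.σ₀ y.σ)).measurable.comp_aemeasurable
    (hc.aemeasurable (P.measurableSet_D y))).aestronglyMeasurable

lemma ae_σ {y : Param M Nσ Nγ} {p : ℝ → Prop}
    (hp : ∀ᵐ x ∂(volume.restrict (enclosed (curveSet P.L (P.γ (Cube.origin Nγ))))),
      p (P.σ₀ y.σ x)) :
    ∀ᵐ x ∂(volume.restrict (P.D y)), p (P.σ y x) := by
  obtain ⟨K, hK⟩ := P.Φ_biLipschitz y.γ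
  exact ae_comp_of_antilipschitz (P.measurableSet_D y) (P.isOpen_domain _).measurableSet
    (P.Φ_bijOn y.γ).mapsTo (fun x hx x' hx' => (hK x hx x' hx').2) hp

lemma ae_abs_σ_le (y : Param M Nσ Nγ) :
    ∀ᵐ x ∂(volume.restrict (P.D y)), |P.σ y x| ≤ ‖P.σ₀ y.σ‖ :=
  P.ae_σ (p := fun s => |s| ≤ ‖P.σ₀ y.σ‖) (ae_abs_le_norm _)

instance (n : ℕ) : Nonempty (Cube n) := ⟨Cube.origin n⟩

/-- Compactness of the parameter cube and continuity of the essential infimum make the minimum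
attained, which is why `ςmin` is positive. -/
lemma exists_isMinOn_essInf : ∃ y₀, ∀ y, essInf (P.σ₀ y₀)
      (volume.restrict (enclosed (curveSet P.L (P.γ (Cube.origin Nγ))))) ≤
    essInf (P.σ₀ y) (volume.restrict (enclosed (curveSet P.L (P.γ (Cube.origin Nγ))))) := by
  have : NeZero (volume.restrict (enclosed (curveSet P.L (P.γ (Cube.origin Nγ))))) := by
    refine ⟨fun h0 => ?_⟩
    have h := P.σ₀_pos (Cube.origin Nσ)
    -- The type of `P.σ₀ y` depends on the measure, so the measure is generalized before being
    -- replaced by `0`.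
    have h1 : ∀ (μ : Measure Plane) (f : Plane → ℝ), μ = 0 → 0 < essInf f μ → False := by
      rintro _ f rfl hf
      rw [essInf_measure_zero_real] at hf
      exact lt_irrefl _ hf
    exact h1 _ _ h0 h
  obtain ⟨y₀, -, h⟩ := isCompact_univ.exists_isMinOn univ_nonempty
    (continuous_essInf_Linfty.comp P.σ₀_continuous).continuousOn
  exact ⟨y₀, fun y => h (mem_univ y)⟩

lemma ςmin_pos : 0 < P.ςmin := by
  obtain ⟨y₀, h⟩ := P.exists_isMinOn_essInf
  exact (P.σ₀_pos y₀).trans_le (le_ciInf h)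

lemma ae_ςmin_le_σ (y : Param M Nσ Nγ) :
    ∀ᵐ x ∂(volume.restrict (P.D y)), P.ςmin ≤ P.σ y x := by
  refine P.ae_σ (p := fun s => P.ςmin ≤ s) ?_
  obtain ⟨y₀, h⟩ := P.exists_isMinOn_essInf
  filter_upwards [ae_essInf_le_Linfty (P.σ₀ y.σ)] with x hx
  exact le_trans (ciInf_le ⟨_, forall_mem_range.2 h⟩ y.σ) hx

lemma z_le_ζmax (y : Cube M) (m : Fin M) : P.z y m ≤ P.ζmax := by
  refine le_trans (le_ciSup (f := fun y => P.z y m) ?_ y)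
    (le_ciSup (f := fun m => ⨆ y, P.z y m) (finite_range _).bddAbove m)
  exact (isCompact_range ((continuous_apply m).comp P.z_continuous)).bddAbove

/-! ### Electrodes of the set-up -/

instance isFiniteMeasure_S (y : Param M Nσ Nγ) : IsFiniteMeasure (P.S y) :=
  (P.isClosedCurve y.γ).isFiniteMeasure

lemma ae_notMem_D (y : Param M Nσ Nγ) : ∀ᵐ x ∂(P.S y), x ∉ P.D y := by
  filter_upwards [(P.isClosedCurve y.γ).ae_mem_curveSet] with x hx hD
  exact hD.1 hx

lemma measurableSet_E (y : Param M Nσ Nγ) (m : Fin M) : MeasurableSet (P.E y m) :=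
  (P.isClosedCurve y.γ).measurableSet_electrode (P.θ_mem _ m) _

lemma disjoint_E (y : Param M Nσ Nγ) {j k : Fin M} (h : j ≠ k) : Disjoint (P.E y j) (P.E y k) :=
  (P.isClosedCurve y.γ).disjoint_electrode (P.θ_mem _ j) (P.θ_mem _ k)
    (P.no_overlap j k h _ _) (P.no_overlap k j h.symm _ _)

/-- With `M ≥ 2` some other electrode starts at arc distance more than `ω`, and that distance is at
most the full length. -/
lemma lt_length (hM : 2 ≤ M) (y : Param M Nσ Nγ) (m : Fin M) :
    P.ω < ∫ s in P.θ y.E m..P.θ y.E m + P.L, ‖deriv (P.γ y.γ) s‖ := by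
  have : Nontrivial (Fin M) := Fin.nontrivial_iff_two_le.2 hM
  obtain ⟨k, hk⟩ := exists_ne m
  exact (P.no_overlap m k hk.symm y.E y.γ).trans_le
    ((P.isClosedCurve y.γ).arcDist_le_length (P.θ_mem _ m) (P.θ_mem _ k))

lemma ω_le_measure_E (hM : 2 ≤ M) (y : Param M Nσ Nγ) (m : Fin M) :
    P.ω ≤ (P.S y).real (P.E y m) := by
  have h := (P.isClosedCurve y.γ).le_arcMeasure_electrode (P.θ_mem y.E m) P.ω_pos
    (P.lt_length hM y m)
  exact (ENNReal.ofReal_le_iff_le_toReal (measure_ne_top (P.S y) _)).1 h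

lemma ae_closure_E (hM : 2 ≤ M) (y : Param M Nσ Nγ) :
    ∀ᵐ x ∂(P.S y), x ∈ closure (⋃ m, P.E y m) → x ∈ ⋃ m, P.E y m := by
  have h : ∀ᵐ x ∂(P.S y), ∀ m, x ∈ closure (P.E y m) → x ∈ P.E y m :=
    ae_all_iff.2 fun m => (P.isClosedCurve y.γ).ae_closure_electrode (P.θ_mem _ m)
      (P.lt_length hM y m)
  filter_upwards [h] with x hx hc
  rw [closure_iUnion_of_finite, mem_iUnion] at hc
  obtain ⟨m, hm⟩ := hc
  exact mem_iUnion.2 ⟨m, hx m hm⟩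

end Setup

/-! ### Bilinear forms -/

/-- The bilinear form `(f, g) ↦ ∫ w f·g dμ` on `L²(μ; F)` with a bounded weight `w`. -/
def weightedForm {α F : Type*} [MeasurableSpace α] {μ : Measure α} [NormedAddCommGroup F]
    [InnerProductSpace ℝ F] {w : α → ℝ} (hw : MemLp w ∞ μ) :
    Lp F 2 μ →L[ℝ] Lp F 2 μ →L[ℝ] ℝ :=
  (innerSL ℝ).comp ((ContinuousLinearMap.lsmul ℝ ℝ : ℝ →L[ℝ] F →L[ℝ] F).holderL μ ∞ 2 2
    (hw.toLp w))

lemma weightedForm_apply {α F : Type*} [MeasurableSpace α] {μ : Measure α} [NormedAddCommGroup F]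
    [InnerProductSpace ℝ F] {w : α → ℝ} (hw : MemLp w ∞ μ) (f g : Lp F 2 μ) :
    weightedForm hw f g = ∫ x, w x * inner ℝ (f x) (g x) ∂μ := by
  change inner ℝ ((ContinuousLinearMap.lsmul ℝ ℝ : ℝ →L[ℝ] F →L[ℝ] F).holder 2 (hw.toLp w) f) g = _
  rw [L2.inner_def]
  refine integral_congr_ae ?_
  filter_upwards [(ContinuousLinearMap.lsmul ℝ ℝ : ℝ →L[ℝ] F →L[ℝ] F).coeFn_holder (r := 2)
    (hw.toLp w) f, hw.coeFn_toLp] with x h1 h2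
  rw [h1, h2, ContinuousLinearMap.lsmul_apply, real_inner_smul_left]

/-- The Lax–Milgram theorem for a bounded bilinear form that is coercive modulo a closed subspace
on which the form and the functional vanish. -/
lemma exists_orthogonal_solution {H : Type*} [NormedAddCommGroup H] [InnerProductSpace ℝ H]
    [CompleteSpace H] (K : Submodule ℝ H) [K.HasOrthogonalProjection]
    (b : H →L[ℝ] H →L[ℝ] ℝ) (l : H →L[ℝ] ℝ) (hb : ∀ p, ∀ k ∈ K, b p k = 0) (hl : ∀ k ∈ K, l k = 0)
    {C : ℝ} (hC : 0 < C) (hcoer : ∀ p ∈ Kᗮ, ‖p‖ ^ 2 ≤ C * b p p) :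
    ∃ p ∈ Kᗮ, ∀ q, b p q = l q := by
  set b' : Kᗮ →L[ℝ] Kᗮ →L[ℝ] ℝ := b.bilinearComp Kᗮ.subtypeL Kᗮ.subtypeL with hb'
  have hco : IsCoercive b' := by
    refine ⟨C⁻¹, inv_pos.2 hC, fun p => ?_⟩
    rw [mul_assoc, inv_mul_le_iff₀ hC, ← sq]
    exact hcoer p p.2
  set f := (InnerProductSpace.toDual ℝ Kᗮ).symm (l.comp Kᗮ.subtypeL) with hf
  refine ⟨hco.continuousLinearEquivOfBilin.symm f, Subtype.mem _, fun q => ?_⟩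
  have h1 : ∀ w : Kᗮ, b (hco.continuousLinearEquivOfBilin.symm f) w = l w := fun w => by
    have := hco.continuousLinearEquivOfBilin_apply (hco.continuousLinearEquivOfBilin.symm f) w
    rw [ContinuousLinearEquiv.apply_symm_apply, hf, InnerProductSpace.toDual_symm_apply] at this
    exact this.symm
  -- Both sides vanish on `K`, so solving against `Kᗮ` solves against every `q`.
  obtain ⟨k, hk, w, hw, rfl⟩ := K.exists_add_mem_mem_orthogonal q
  rw [map_add, map_add, hb _ k hk, hl k hk]
  exact congrArg (0 + ·) (h1 ⟨w, hw⟩)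

/-! ### The energy form as a bounded bilinear map -/

namespace Setup

variable {M Nσ Nγ : ℕ} (P : Setup M Nσ Nγ) (y : Param M Nσ Nγ)

lemma memLp_σ : MemLp (P.σ y) ∞ (volume.restrict (P.D y)) :=
  memLp_top_of_bound (P.aestronglyMeasurable_σ y) _ (P.ae_abs_σ_le y)

lemma memLp_indicator_E (m : Fin M) :
    MemLp ((P.E y m).indicator fun _ => (1 : ℝ)) ∞ (P.S y) :=
  (memLp_const 1).indicator (P.measurableSet_E y m)

variable {y}

/-- The map `(v, V) ↦ Vₘ - v|_Γ`. -/
def residual (hT : traceConst (P.D y) (P.S y) ≠ ⊤) (m : Fin M) :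
    Pre (P.D y) M →L[ℝ] Lp ℝ 2 (P.S y) :=
  ((EuclideanSpace.proj m).comp (WithLp.sndL 2 ℝ _ _)).smulRight
      ((memLp_const (1 : ℝ)).toLp (fun _ : Plane => (1 : ℝ))) -
    (trL hT).comp (WithLp.fstL 2 ℝ _ _)

lemma residual_apply (hT : traceConst (P.D y) (P.S y) ≠ ⊤) (m : Fin M) (p : Pre (P.D y) M) :
    P.residual hT m p =ᵐ[P.S y] fun x => p.snd m - tr (P.S y) p.fst x := by
  have hc : MemLp (fun _ : Plane => (1 : ℝ)) 2 (P.S y) := memLp_const 1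
  change ((p.snd m • hc.toLp _ - tr (P.S y) p.fst : Lp ℝ 2 (P.S y)) : Plane → ℝ) =ᵐ[P.S y] _
  filter_upwards [Lp.coeFn_sub (p.snd m • hc.toLp _) (tr (P.S y) p.fst),
    Lp.coeFn_smul (p.snd m) (hc.toLp _), hc.coeFn_toLp] with x h1 h2 h3
  rw [h1, Pi.sub_apply, h2, Pi.smul_apply, h3, smul_eq_mul, mul_one]

/-- The form `B^y` as a continuous bilinear map. -/
def formL (hT : traceConst (P.D y) (P.S y) ≠ ⊤) :
    Pre (P.D y) M →L[ℝ] Pre (P.D y) M →L[ℝ] ℝ :=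
  (weightedForm (P.memLp_σ y)).bilinearComp ((wgradL (P.D y)).comp (WithLp.fstL 2 ℝ _ _))
      ((wgradL (P.D y)).comp (WithLp.fstL 2 ℝ _ _)) +
    ∑ m, (1 / P.z y.z m) • (weightedForm (P.memLp_indicator_E y m)).bilinearComp
      (P.residual hT m) (P.residual hT m)

lemma weightedForm_residual (hT : traceConst (P.D y) (P.S y) ≠ ⊤) (m : Fin M)
    (p q : Pre (P.D y) M) :
    weightedForm (P.memLp_indicator_E y m) (P.residual hT m p) (P.residual hT m q) =
      ∫ x in P.E y m, (p.snd m - tr (P.S y) p.fst x) * (q.snd m - tr (P.S y) q.fst x) ∂(P.S y) := by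
  rw [weightedForm_apply, ← integral_indicator (P.measurableSet_E y m)]
  refine integral_congr_ae ?_
  filter_upwards [P.residual_apply hT m p, P.residual_apply hT m q] with x h1 h2
  rw [h1, h2]
  by_cases hx : x ∈ P.E y m
  · rw [indicator_of_mem hx, indicator_of_mem hx, one_mul]
    exact mul_comm _ _
  · rw [indicator_of_notMem hx, indicator_of_notMem hx, zero_mul]

lemma formL_apply (hT : traceConst (P.D y) (P.S y) ≠ ⊤) (p q : Pre (P.D y) M) :
    P.formL hT p q = P.B y p q := by
  simp only [formL, add_apply, sum_apply, smul_apply, ContinuousLinearMap.bilinearComp_apply,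
    weightedForm_residual, smul_eq_mul]
  rw [weightedForm_apply]
  rfl

lemma B_comm (p q : Pre (P.D y) M) : P.B y p q = P.B y q p := by
  rw [B, B]
  congr 1
  · exact integral_congr_ae 
      (Eventually.of_forall fun x => congrArg (P.σ y x * ·) (real_inner_comm _ _))
  · exact Finset.sum_congr rfl fun m _ => congrArg _
      (integral_congr_ae (Eventually.of_forall fun x => mul_comm _ _))

/-! ### Coercivity -/

lemma ςmin_mul_le_integral (u : H1 (P.D y)) :
    P.ςmin * ‖wgrad u‖ ^ 2 ≤
      ∫ x in P.D y, P.σ y x * inner ℝ (wgrad u x) (wgrad u x) := by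
  have hi : Integrable (fun x => inner ℝ (wgrad u x) (wgrad u x)) (volume.restrict (P.D y)) :=
    L2.integrable_inner _ _
  rw [← real_inner_self_eq_norm_sq, L2.inner_def, ← integral_const_mul]
  refine integral_mono_ae (hi.const_mul _) ?_ ?_
  · exact hi.bdd_mul (P.aestronglyMeasurable_σ y) (P.ae_abs_σ_le y)
  · filter_upwards [P.ae_ςmin_le_σ y] with x hx
    exact mul_le_mul_of_nonneg_right hx real_inner_self_nonneg

lemma integrable_sq_residual (p : Pre (P.D y) M) (m : Fin M) :
    Integrable (fun x => (p.snd m - tr (P.S y) p.fst x) ^ 2) (P.S y) :=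
  ((memLp_const (p.snd m)).sub (Lp.memLp (tr (P.S y) p.fst))).integrable_sq

lemma tr_sub_one (hT : traceConst (P.D y) (P.S y) ≠ ⊤) (v : H1 (P.D y)) (c : ℝ) :
    tr (P.S y) (v - c • one (P.isBounded_D y) (P.measurableSet_D y)) =ᵐ[P.S y]
      fun x => tr (P.S y) v x - c := by
  rw [← trL_apply hT, map_sub, map_smul, trL_apply, trL_apply]
  filter_upwards [tr_one hT (P.isBounded_D y) (P.measurableSet_D y),
    Lp.coeFn_sub (tr (P.S y) v)
      (c • tr (P.S y) (one (P.isBounded_D y) (P.measurableSet_D y))),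
    Lp.coeFn_smul c (tr (P.S y) (one (P.isBounded_D y) (P.measurableSet_D y)))] with x h1 h2 h3
  rw [h2, Pi.sub_apply, h3, Pi.smul_apply, h1, smul_eq_mul, mul_one]

/-- Integrate the constant `(Vₘ - c)²` over `Eₘ`, whose length is at least `ω`, and use `(a + b)² ≤
2a² + 2b²` with `a = Vₘ - v`, `b = v - c`. Disjointness of the electrodes lets the `b` terms be
summed into one trace norm. -/
lemma sum_sq_le (hM : 2 ≤ M) (hT : traceConst (P.D y) (P.S y) ≠ ⊤) (p : Pre (P.D y) M) (c : ℝ) :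
    P.ω * ∑ m, (p.snd m - c) ^ 2 ≤
      2 * ∑ m, ∫ x in P.E y m, (p.snd m - tr (P.S y) p.fst x) ^ 2 ∂(P.S y) +
      2 * ‖tr (P.S y) (p.fst - c • one (P.isBounded_D y) (P.measurableSet_D y))‖ ^ 2 := by
  set t := tr (P.S y) (p.fst - c • one (P.isBounded_D y) (P.measurableSet_D y)) with ht
  have hti : Integrable (fun x => t x ^ 2) (P.S y) := (Lp.memLp t).integrable_sq
  have h1 : ∀ m, P.ω * (p.snd m - c) ^ 2 ≤
      2 * ∫ x in P.E y m, (p.snd m - tr (P.S y) p.fst x) ^ 2 ∂(P.S y) +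
      2 * ∫ x in P.E y m, t x ^ 2 ∂(P.S y) := by
    intro m
    calc P.ω * (p.snd m - c) ^ 2 ≤ (P.S y).real (P.E y m) * (p.snd m - c) ^ 2 :=
          mul_le_mul_of_nonneg_right (P.ω_le_measure_E hM y m) (sq_nonneg _)
      _ = ∫ x in P.E y m, (p.snd m - c) ^ 2 ∂(P.S y) := by
          rw [setIntegral_const, smul_eq_mul]
      _ ≤ ∫ x in P.E y m, (2 * (p.snd m - tr (P.S y) p.fst x) ^ 2 + 2 * t x ^ 2) ∂(P.S y) := by
          refine integral_mono_ae (integrable_const _)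
            (((P.integrable_sq_residual p m).const_mul 2).add (hti.const_mul 2)).restrict ?_
          filter_upwards [ae_restrict_of_ae (P.tr_sub_one hT p.fst c)] with x hx
          rw [ht, hx]
          nlinarith [sq_nonneg ((p.snd m - tr (P.S y) p.fst x) - (tr (P.S y) p.fst x - c))]
      _ = _ := by
          rw [integral_add ((P.integrable_sq_residual p m).const_mul 2).restrict
            (hti.const_mul 2).restrict, integral_const_mul, integral_const_mul]
  have h2 : ∑ m, ∫ x in P.E y m, t x ^ 2 ∂(P.S y) ≤ ‖t‖ ^ 2 := by
    rw [← integral_iUnion_fintype (P.measurableSet_E y) (fun j k h => P.disjoint_E y h)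
      fun m => hti.integrableOn, ← real_inner_self_eq_norm_sq, L2.inner_def]
    refine (setIntegral_le_integral hti (Eventually.of_forall fun x => sq_nonneg _)).trans ?_
    refine (integral_congr_ae (Eventually.of_forall fun x => ?_)).le
    simp [sq]
  rw [Finset.mul_sum]
  refine (Finset.sum_le_sum fun m _ => h1 m).trans ?_
  rw [Finset.sum_add_distrib, ← Finset.mul_sum, ← Finset.mul_sum]
  linarith

lemma norm_sq_Pre {D : Set Plane} (p : Pre D M) : ‖p‖ ^ 2 = ‖p.fst‖ ^ 2 + ∑ m, p.snd m ^ 2 := by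
  rw [WithLp.prod_norm_sq_eq_of_L2, EuclideanSpace.norm_sq_eq]
  simp

lemma traceConst_ne_top {P : Setup M Nσ Nγ} (hCtr : P.Ctr ≠ ⊤) (y : Param M Nσ Nγ) :
    traceConst (P.D y) (P.S y) ≠ ⊤ :=
  ne_top_of_le_ne_top hCtr (le_iSup (fun y => traceConst (P.D y) (P.S y)) y)

lemma poincareConst_ne_top {P : Setup M Nσ Nγ} (hCP : P.CP ≠ ⊤) (y : Param M Nσ Nγ) :
    poincareConst (P.D y) ≠ ⊤ :=
  ne_top_of_le_ne_top hCP (le_iSup (fun y => poincareConst (P.D y)) y)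

/-- The constant in the a priori estimate. -/
def stabConst : ℝ :=
  max (P.CP.toReal ^ 2 / P.ςmin * (1 + 2 * P.Ctr.toReal ^ 2 / P.ω)) (2 * P.ζmax / P.ω)

lemma ζmax_pos (hM : 2 ≤ M) (y : Param M Nσ Nγ) : 0 < P.ζmax :=
  (P.z_pos y.z ⟨0, by omega⟩).trans_le (P.z_le_ζmax y.z _)

lemma stabConst_pos (hM : 2 ≤ M) (y : Param M Nσ Nγ) : 0 < P.stabConst :=
  lt_max_of_lt_right (div_pos (mul_pos two_pos (P.ζmax_pos hM y)) P.ω_pos)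

lemma norm_tr_sub_mean_le (hCtr : P.Ctr ≠ ⊤) (hCP : P.CP ≠ ⊤) (v : H1 (P.D y)) :
    ‖tr (P.S y) (v - (⨍ t in P.D y, fn v t) • one (P.isBounded_D y) (P.measurableSet_D y))‖ ≤
      P.Ctr.toReal * (P.CP.toReal * ‖wgrad v‖) ∧
    ‖v - (⨍ t in P.D y, fn v t) • one (P.isBounded_D y) (P.measurableSet_D y)‖ ≤
      P.CP.toReal * ‖wgrad v‖ := by
  have h1 := poincare_le (poincareConst_ne_top hCP y) (P.isBounded_D y) (P.measurableSet_D y) v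
  have h2 : (poincareConst (P.D y)).toReal ≤ P.CP.toReal :=
    ENNReal.toReal_mono hCP (le_iSup (fun y => poincareConst (P.D y)) y)
  have h3 : (traceConst (P.D y) (P.S y)).toReal ≤ P.Ctr.toReal :=
    ENNReal.toReal_mono hCtr (le_iSup (fun y => traceConst (P.D y) (P.S y)) y)
  have h4 := h1.trans (mul_le_mul_of_nonneg_right h2 (norm_nonneg _))
  exact ⟨(norm_tr_le (traceConst_ne_top hCtr y) _).trans
    (mul_le_mul h3 h4 (norm_nonneg _) ENNReal.toReal_nonneg), h4⟩

/-- The origin of the stability constant, with `A = C_P`, `T = C_tr`, `G = ‖∇v‖`, `J` the volume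
energy and `Q` the electrode energy. The gradient terms combine to the first entry of the maximum
times `ς G²`, and the residual term carries the second entry times `Q`. -/
lemma add_le_max_mul {ω ς ζ A T G Q V n J : ℝ} (hω : 0 < ω) (hς : 0 < ς) (hζ : 0 < ζ)
    (hQ : 0 ≤ Q) (hn : n ≤ (A * G) ^ 2) (hV : ω * V ≤ 2 * (ζ * Q) + 2 * (T * (A * G)) ^ 2)
    (hJ : ς * G ^ 2 ≤ J) :
    n + V ≤ max (A ^ 2 / ς * (1 + 2 * T ^ 2 / ω)) (2 * ζ / ω) * (J + Q) := by
  have hV' : V ≤ 2 * ζ / ω * Q + 2 / ω * (T * (A * G)) ^ 2 := by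
    rw [← mul_le_mul_iff_right₀ hω]
    refine hV.trans (le_of_eq ?_)
    field_simp
  have hK : 0 < max (A ^ 2 / ς * (1 + 2 * T ^ 2 / ω)) (2 * ζ / ω) :=
    lt_max_of_lt_right (by positivity)
  calc n + V ≤ (A * G) ^ 2 + (2 * ζ / ω * Q + 2 / ω * (T * (A * G)) ^ 2) := add_le_add hn hV'
    _ = A ^ 2 / ς * (1 + 2 * T ^ 2 / ω) * (ς * G ^ 2) + 2 * ζ / ω * Q := by
        field_simp
        ring
    _ ≤ max (A ^ 2 / ς * (1 + 2 * T ^ 2 / ω)) (2 * ζ / ω) * (ς * G ^ 2) +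
        max (A ^ 2 / ς * (1 + 2 * T ^ 2 / ω)) (2 * ζ / ω) * Q :=
        add_le_add (mul_le_mul_of_nonneg_right (le_max_left _ _) (by positivity))
          (mul_le_mul_of_nonneg_right (le_max_right _ _) hQ)
    _ ≤ _ := by
        rw [mul_add _ J Q]
        exact add_le_add (mul_le_mul_of_nonneg_left hJ hK.le) le_rfl

lemma sum_le_ζmax_mul (y : Cube M) {R : Fin M → ℝ} (hR : ∀ m, 0 ≤ R m) :
    ∑ m, R m ≤ P.ζmax * ∑ m, 1 / P.z y m * R m := by
  rw [Finset.mul_sum]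
  refine Finset.sum_le_sum fun m _ => ?_
  rw [← mul_assoc, mul_one_div]
  exact le_mul_of_one_le_left (hR m) ((one_le_div (P.z_pos _ _)).2 (P.z_le_ζmax _ _))

lemma norm_sq_sub_onePair {D : Set Plane} (hb : Bornology.IsBounded D) (hm : MeasurableSet D)
    (p : Pre D M) (c : ℝ) : ‖p - c • onePair hb hm M‖ ^ 2 =
      ‖p.fst - c • one hb hm‖ ^ 2 + ∑ m, (p.snd m - c) ^ 2 := by
  rw [norm_sq_Pre]
  congr 1
  refine Finset.sum_congr rfl fun m _ => ?_
  change (p.snd m - c * 1) ^ 2 = _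
  rw [mul_one]

lemma B_self (p : Pre (P.D y) M) : P.B y p p =
    (∫ x in P.D y, P.σ y x * inner ℝ (wgrad p.fst x) (wgrad p.fst x)) +
      ∑ m, 1 / P.z y.z m * ∫ x in P.E y m, (p.snd m - tr (P.S y) p.fst x) ^ 2 ∂(P.S y) := by
  simp only [B, sq]

/-- Coercivity modulo constants. The mean of `v` need not be the best constant for the pair, but it
is the one the Poincaré inequality controls. -/
lemma norm_sq_sub_mean_le (hCtr : P.Ctr ≠ ⊤) (hCP : P.CP ≠ ⊤) (hM : 2 ≤ M)
    (p : Pre (P.D y) M) :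
    ‖p - (⨍ t in P.D y, fn p.fst t) • onePair (P.isBounded_D y) (P.measurableSet_D y) M‖ ^ 2 ≤
      P.stabConst * P.B y p p := by
  obtain ⟨h1, h2⟩ := P.norm_tr_sub_mean_le hCtr hCP p.fst
  have h3 := P.sum_sq_le hM (traceConst_ne_top hCtr y) p (⨍ t in P.D y, fn p.fst t)
  have hR0 : ∀ m, 0 ≤ ∫ x in P.E y m, (p.snd m - tr (P.S y) p.fst x) ^ 2 ∂(P.S y) :=
    fun m => integral_nonneg fun x => sq_nonneg _
  rw [norm_sq_sub_onePair, B_self, stabConst]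
  refine add_le_max_mul P.ω_pos P.ςmin_pos (P.ζmax_pos hM y)
    (Finset.sum_nonneg fun m _ => mul_nonneg (one_div_nonneg.2 (P.z_pos _ _).le) (hR0 m))
    (pow_le_pow_left₀ (norm_nonneg _) h2 2) (h3.trans ?_) (P.ςmin_mul_le_integral p.fst)
  exact add_le_add (mul_le_mul_of_nonneg_left (P.sum_le_ζmax_mul y.z hR0) zero_le_two)
    (mul_le_mul_of_nonneg_left (pow_le_pow_left₀ (norm_nonneg _) h1 2) zero_le_two)

end Setup

namespace Setup

variable {M Nσ Nγ : ℕ} (P : Setup M Nσ Nγ) {y : Param M Nσ Nγ}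

/-! ### The boundary value problem and its variational formulation -/

/-- The current density on `Γ^y` given by the Robin condition: `(Uₘ - u) / zₘ` on `E^y_m` and `0`
off the electrodes. -/
def currentDensity (p : Pre (P.D y) M) (x : Plane) : ℝ :=
  ∑ m, (P.E y m).indicator (fun x => 1 / P.z y.z m * (p.snd m - tr (P.S y) p.fst x)) x

lemma currentDensity_of_mem (p : Pre (P.D y) M) {m : Fin M} {x : Plane} (hx : x ∈ P.E y m) :
    P.currentDensity p x = 1 / P.z y.z m * (p.snd m - tr (P.S y) p.fst x) := by
  rw [currentDensity, Finset.sum_eq_single m, indicator_of_mem hx]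
  · exact fun k _ hk => indicator_of_notMem (disjoint_left.1 (P.disjoint_E y hk.symm) hx) _
  · exact fun h => (h (Finset.mem_univ m)).elim

lemma currentDensity_of_notMem (p : Pre (P.D y) M) {x : Plane} (hx : x ∉ ⋃ m, P.E y m) :
    P.currentDensity p x = 0 :=
  Finset.sum_eq_zero fun m _ => indicator_of_notMem (fun h => hx (mem_iUnion.2 ⟨m, h⟩)) _

lemma memLp_currentDensity (p : Pre (P.D y) M) : MemLp (P.currentDensity p) 2 (P.S y) :=
  memLp_finsetSum _ fun m _ => MemLp.indicator (P.measurableSet_E y m)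
    (((memLp_const (p.snd m)).sub (Lp.memLp (tr (P.S y) p.fst))).const_mul _)

/-- Expanding `Vₘ - v` separates the net currents from a boundary pairing. The latter is an integral
over the whole curve because the density vanishes off the disjoint electrodes. Both formulations are
compared through this identity. -/
lemma B_eq_currentDensity (p q : Pre (P.D y) M) :
    P.B y p q = (∫ x in P.D y, P.σ y x * inner ℝ (wgrad p.fst x) (wgrad q.fst x)) +
      ∑ m, q.snd m * (∫ x in P.E y m, P.currentDensity p x ∂(P.S y)) -
      ∫ x, P.currentDensity p x * tr (P.S y) q.fst x ∂(P.S y) := by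
  have hF := P.memLp_currentDensity p
  have hFi : Integrable (P.currentDensity p) (P.S y) := hF.integrable (by norm_num)
  have hFt : Integrable (fun x => P.currentDensity p x * tr (P.S y) q.fst x) (P.S y) :=
    hF.integrable_mul (Lp.memLp (tr (P.S y) q.fst))
  have h1 : ∀ m, (1 / P.z y.z m) * ∫ x in P.E y m,
      (p.snd m - tr (P.S y) p.fst x) * (q.snd m - tr (P.S y) q.fst x) ∂(P.S y) =
      q.snd m * (∫ x in P.E y m, P.currentDensity p x ∂(P.S y)) -
        ∫ x in P.E y m, P.currentDensity p x * tr (P.S y) q.fst x ∂(P.S y) := by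
    intro m
    rw [← integral_const_mul, ← integral_const_mul,
      ← integral_sub (hFi.const_mul _).restrict hFt.restrict]
    refine setIntegral_congr_fun (P.measurableSet_E y m) fun x hx => ?_
    simp only [P.currentDensity_of_mem p hx]
    ring
  have h2 : ∫ x, P.currentDensity p x * tr (P.S y) q.fst x ∂(P.S y) =
      ∑ m, ∫ x in P.E y m, P.currentDensity p x * tr (P.S y) q.fst x ∂(P.S y) := by
    rw [← integral_iUnion_fintype (P.measurableSet_E y) (fun j k h => P.disjoint_E y h)
      fun m => hFt.integrableOn, setIntegral_eq_integral_of_forall_compl_eq_zero]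
    intro x hx
    rw [P.currentDensity_of_notMem p hx, zero_mul]
  rw [B, Finset.sum_congr rfl fun m _ => h1 m, Finset.sum_sub_distrib, h2, add_sub_assoc]

/-- Testing with `(v, 0)` shows that the Robin density is the conormal derivative; zero-trace test
functions then give the interior equation. Testing with `(0, eₘ)` gives the net current through
`Eₘ`. -/
lemma isSolution_of_isVariationalSolution (hT : traceConst (P.D y) (P.S y) ≠ ⊤)
    {I : EuclideanSpace ℝ (Fin M)} {p : Pre (P.D y) M} (h : P.IsVariationalSolution y I p) :
    P.IsSolution y I p := by
  have hF := P.memLp_currentDensity p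
  have hFe := hF.coeFn_toLp
  have hcon : P.IsConormalDerivative y p.fst (hF.toLp _) := by
    intro v
    have h1 := h (WithLp.toLp 2 (v, 0))
    rw [P.B_eq_currentDensity] at h1
    simp only [WithLp.toLp_fst, WithLp.toLp_snd, PiLp.zero_apply, zero_mul, mul_zero,
      Finset.sum_const_zero, add_zero] at h1
    rw [sub_eq_zero.1 h1]
    refine integral_congr_ae ?_
    filter_upwards [hFe] with x hx
    rw [hx]
  refine ⟨fun φ hφ => ?_, hF.toLp _, hcon, ?_, fun m => ?_, fun m => ?_⟩
  · have h1 := hcon (ofSmooth (P.isBounded_D y) (P.measurableSet_D y) φ hφ.1)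
    rw [tr_test hT _ _ (P.ae_notMem_D y) hφ] at h1
    have h2 : ∫ x, hF.toLp _ x * (0 : Lp ℝ 2 (P.S y)) x ∂(P.S y) = 0 := by
      refine integral_eq_zero_of_ae ?_
      filter_upwards [Lp.coeFn_zero ℝ 2 (P.S y)] with x hx
      rw [hx, Pi.zero_apply, mul_zero]
    rw [h2] at h1
    rw [← h1]
    refine integral_congr_ae ?_
    filter_upwards [wgrad_ofSmooth (P.isBounded_D y) (P.measurableSet_D y) hφ.1] with x hx
    rw [hx]
  · filter_upwards [hFe] with x hx hcl
    rw [hx, P.currentDensity_of_notMem p fun h => hcl (subset_closure h)]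
  · filter_upwards [hFe] with x hx hm
    have hz := (P.z_pos y.z m).ne'
    rw [hx, P.currentDensity_of_mem p hm, one_div, mul_inv_cancel_left₀ hz, add_sub_cancel]
  · have h1 := h (WithLp.toLp 2 (0, EuclideanSpace.single m 1))
    have h0 : tr (P.S y) (0 : H1 (P.D y)) = 0 := map_zero (trL hT)
    have h2 : ∫ x in P.D y, P.σ y x * inner ℝ (wgrad p.fst x) (wgrad (0 : H1 (P.D y)) x) = 0 := by
      refine integral_eq_zero_of_ae ?_
      filter_upwards [Lp.coeFn_zero Plane 2 (volume.restrict (P.D y))] with x hx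
      change P.σ y x * inner ℝ (wgrad p.fst x) ((0 : Lp Plane 2 (volume.restrict (P.D y))) x) = 0
      rw [hx, Pi.zero_apply, inner_zero_right, mul_zero]
    have h3 : ∫ x, P.currentDensity p x * (0 : Lp ℝ 2 (P.S y)) x ∂(P.S y) = 0 := by
      refine integral_eq_zero_of_ae ?_
      filter_upwards [Lp.coeFn_zero ℝ 2 (P.S y)] with x hx
      rw [hx, Pi.zero_apply, mul_zero]
    rw [P.B_eq_currentDensity] at h1
    simp only [WithLp.toLp_fst, WithLp.toLp_snd] at h1
    rw [h0, h2, h3, zero_add, sub_zero] at h1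
    simp only [PiLp.single_apply, ite_mul, one_mul, zero_mul, mul_ite, mul_one, mul_zero,
      Finset.sum_ite_eq', Finset.mem_univ, if_true] at h1
    rw [← h1]
    refine setIntegral_congr_ae (P.measurableSet_E y m) ?_
    filter_upwards [hFe] with x hx _ using hx

/-- The Robin condition on the electrodes and zero flux off their closure fix `f` almost everywhere,
as the set in between is null. Green's formula then cancels the boundary pairing in
`B_eq_currentDensity`. -/
lemma isVariationalSolution_of_isSolution (hM : 2 ≤ M) {I : EuclideanSpace ℝ (Fin M)}
    {p : Pre (P.D y) M} (h : P.IsSolution y I p) : P.IsVariationalSolution y I p := by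
  obtain ⟨-, f, hcon, h0, hR, hI⟩ := h
  have hf : f =ᵐ[P.S y] P.currentDensity p := by
    filter_upwards [h0, ae_all_iff.2 hR, P.ae_closure_E hM y] with x h1 h2 h3
    by_cases hx : x ∈ ⋃ m, P.E y m
    · obtain ⟨m, hm⟩ := mem_iUnion.1 hx
      rw [P.currentDensity_of_mem p hm, ← h2 m hm, add_sub_cancel_left, one_div,
        inv_mul_cancel_left₀ (P.z_pos y.z m).ne']
    · rw [P.currentDensity_of_notMem p hx, h1 fun h => hx (h3 h)]
  intro q
  have e1 : ∫ x, P.currentDensity p x * tr (P.S y) q.fst x ∂(P.S y) =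
      ∫ x, f x * tr (P.S y) q.fst x ∂(P.S y) := by
    refine integral_congr_ae ?_
    filter_upwards [hf] with x hx
    rw [hx]
  have e2 : ∀ m, ∫ x in P.E y m, P.currentDensity p x ∂(P.S y) = I m := fun m => by
    rw [← hI m]
    exact (integral_congr_ae (ae_restrict_of_ae hf)).symm
  rw [P.B_eq_currentDensity, e1, hcon q.fst]
  simp only [e2]
  rw [add_sub_cancel_left]
  exact Finset.sum_congr rfl fun m _ => mul_comm _ _

/-! ### Existence, uniqueness and stability -/

lemma formL_onePair (hT : traceConst (P.D y) (P.S y) ≠ ⊤) (p : Pre (P.D y) M) :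
    P.formL hT p (onePair (P.isBounded_D y) (P.measurableSet_D y) M) = 0 := by
  rw [formL_apply, B]
  have h1 : ∫ x in P.D y, P.σ y x * inner ℝ (wgrad p.fst x)
      (wgrad (one (P.isBounded_D y) (P.measurableSet_D y)) x) = 0 := by
    refine integral_eq_zero_of_ae ?_
    rw [wgrad_one]
    filter_upwards [Lp.coeFn_zero Plane 2 (volume.restrict (P.D y))] with x hx
    rw [hx, Pi.zero_apply, inner_zero_right, mul_zero, Pi.zero_apply]
  refine (congrArg₂ (· + ·) h1 (Finset.sum_eq_zero fun m _ => ?_)).trans (add_zero 0)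
  refine mul_eq_zero_of_right _ (integral_eq_zero_of_ae (ae_restrict_of_ae ?_))
  filter_upwards [tr_one hT (P.isBounded_D y) (P.measurableSet_D y)] with x hx
  change (p.snd m - tr (P.S y) p.fst x) *
    (1 - tr (P.S y) (one (P.isBounded_D y) (P.measurableSet_D y)) x) = 0
  rw [hx, sub_self, mul_zero]

lemma formL_constants (hT : traceConst (P.D y) (P.S y) ≠ ⊤) (p : Pre (P.D y) M) {k : Pre (P.D y) M}
    (hk : k ∈ constants (P.D y) M) : P.formL hT p k = 0 := by
  rw [constants_eq_span (P.isBounded_D y) (P.measurableSet_D y),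
    Submodule.mem_span_singleton] at hk
  obtain ⟨c, rfl⟩ := hk
  rw [map_smul, formL_onePair, smul_zero]

lemma finiteDimensional_constants (y : Param M Nσ Nγ) :
    FiniteDimensional ℝ (constants (P.D y) M) := by
  rw [constants_eq_span (P.isBounded_D y) (P.measurableSet_D y)]
  infer_instance

lemma smul_onePair_mem (y : Param M Nσ Nγ) (c : ℝ) :
    c • onePair (P.isBounded_D y) (P.measurableSet_D y) M ∈ constants (P.D y) M := by
  rw [constants_eq_span (P.isBounded_D y) (P.measurableSet_D y)]
  exact Submodule.smul_mem _ _ (Submodule.mem_span_singleton_self _)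

/-- By Pythagoras, subtracting a constant from an element orthogonal to the constants cannot
decrease its norm, so the estimate for `p - c` passes to `p`. -/
lemma norm_sq_le_of_orthogonal (hCtr : P.Ctr ≠ ⊤) (hCP : P.CP ≠ ⊤) (hM : 2 ≤ M)
    {p : Pre (P.D y) M} (hp : p ∈ (constants (P.D y) M)ᗮ) :
    ‖p‖ ^ 2 ≤ P.stabConst * P.B y p p := by
  refine le_trans ?_ (P.norm_sq_sub_mean_le hCtr hCP hM p)
  have h := norm_sub_sq_eq_norm_sq_add_norm_sq_real
    ((Submodule.mem_orthogonal' _ _).1 hp _ (P.smul_onePair_mem y (⨍ t in P.D y, fn p.fst t)))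
  rw [sq, sq, h]
  exact le_add_of_nonneg_right (mul_self_nonneg _)

/-- The functional `(v, V) ↦ I·V`. -/
def currentL (D : Set Plane) (I : EuclideanSpace ℝ (Fin M)) : Pre D M →L[ℝ] ℝ :=
  (innerSL ℝ I).comp (WithLp.sndL 2 ℝ _ _)

lemma currentL_apply {D : Set Plane} (I : EuclideanSpace ℝ (Fin M)) (q : Pre D M) :
    currentL D I q = ∑ m, I m * q.snd m := by
  change inner ℝ I q.snd = _
  rw [PiLp.inner_apply]
  exact Finset.sum_congr rfl fun m _ => mul_comm _ _

lemma currentL_constants {D : Set Plane} {I : EuclideanSpace ℝ (Fin M)} (hI : ∑ m, I m = 0)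
    {k : Pre D M} (hk : k ∈ constants D M) : currentL D I k = 0 := by
  obtain ⟨c, -, -, hc⟩ := hk
  rw [currentL_apply]
  simp only [hc]
  rw [← Finset.sum_mul, hI, zero_mul]

lemma norm_snd_le {D : Set Plane} (p : Pre D M) : ‖p.snd‖ ≤ ‖p‖ := by
  refine le_of_sq_le_sq ?_ (norm_nonneg _)
  rw [WithLp.prod_norm_sq_eq_of_L2]
  exact le_add_of_nonneg_left (sq_nonneg _)

lemma mem_constants_of_B_self_eq_zero (hCtr : P.Ctr ≠ ⊤) (hCP : P.CP ≠ ⊤) (hM : 2 ≤ M)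
    {d : Pre (P.D y) M} (h : P.B y d d = 0) : d ∈ constants (P.D y) M := by
  have h2 := P.norm_sq_sub_mean_le hCtr hCP hM d
  rw [h, mul_zero] at h2
  have h3 := pow_eq_zero_iff two_ne_zero |>.1 (le_antisymm h2 (sq_nonneg _))
  rw [norm_eq_zero, sub_eq_zero] at h3
  exact h3 ▸ P.smul_onePair_mem y _

lemma B_sub_left (hT : traceConst (P.D y) (P.S y) ≠ ⊤) (p p₀ q : Pre (P.D y) M) :
    P.B y (p - p₀) q = P.B y p q - P.B y p₀ q := by
  have h := congrArg (fun l => l q) ((P.formL hT).map_sub p p₀)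
  simpa only [sub_apply, formL_apply] using h

lemma B_constants_left (hT : traceConst (P.D y) (P.S y) ≠ ⊤) {k : Pre (P.D y) M}
    (hk : k ∈ constants (P.D y) M) (q : Pre (P.D y) M) : P.B y k q = 0 := by
  rw [B_comm, ← P.formL_apply hT]
  exact P.formL_constants hT q hk

/-- The difference of two solutions has zero energy, hence is constant by coercivity. Conversely,
adding a constant changes nothing, since by symmetry `B` also vanishes on constants in its left
argument. -/
lemma isVariationalSolution_iff_cls_eq (hCtr : P.Ctr ≠ ⊤) (hCP : P.CP ≠ ⊤) (hM : 2 ≤ M)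
    {I : EuclideanSpace ℝ (Fin M)} {p₀ : Pre (P.D y) M} (h₀ : P.IsVariationalSolution y I p₀)
    (p : Pre (P.D y) M) : P.IsVariationalSolution y I p ↔ cls p = cls p₀ := by
  have hT := traceConst_ne_top hCtr y
  refine Iff.trans ⟨fun h => ?_, fun h q => ?_⟩
    (Submodule.Quotient.eq (constants (P.D y) M) (x := p) (y := p₀)).symm
  · refine P.mem_constants_of_B_self_eq_zero hCtr hCP hM ?_
    rw [P.B_sub_left hT, h, h₀, sub_self]
  · have h1 := P.B_constants_left hT h q
    rw [P.B_sub_left hT, h₀ q] at h1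
    exact sub_eq_zero.1 h1

end Setup

end CEM

end

/-! ### Well-posedness and the uniform bound -/

theorem mainTheorem2 {M Nσ Nγ : ℕ} (hM : 2 ≤ M) (P : CEM.Setup M Nσ Nγ)
    (hCtr : P.Ctr ≠ ⊤) (hCP : P.CP ≠ ⊤)
    (I : EuclideanSpace ℝ (Fin M)) (hI : ∑ m, I m = 0) (y : CEM.Param M Nσ Nγ) :
    ∃ h : CEM.QuotSpace (P.D y) M,
      (∀ p : CEM.Pre (P.D y) M, P.IsSolution y I p ↔ CEM.cls p = h) ∧
      (∀ p : CEM.Pre (P.D y) M, P.IsVariationalSolution y I p ↔ CEM.cls p = h) ∧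
      ‖h‖ ≤ max (P.CP.toReal ^ 2 / P.ςmin * (1 + 2 * P.Ctr.toReal ^ 2 / P.ω))
        (2 * P.ζmax / P.ω) * ‖I‖ := by
  have hT := CEM.Setup.traceConst_ne_top hCtr y
  have hK := P.stabConst_pos hM y
  have := P.finiteDimensional_constants y
  obtain ⟨p₀, hp₀, hsol⟩ := CEM.exists_orthogonal_solution (CEM.constants (P.D y) M) (P.formL hT)
    (CEM.Setup.currentL (P.D y) I) (fun p k hk => P.formL_constants hT p hk)
    (fun k hk => CEM.Setup.currentL_constants hI hk) hK
    (fun p hp => P.formL_apply hT p p ▸ P.norm_sq_le_of_orthogonal hCtr hCP hM hp)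
  have hvar : P.IsVariationalSolution y I p₀ := fun q => by
    rw [← P.formL_apply hT, hsol q, CEM.Setup.currentL_apply]
  have hiff := P.isVariationalSolution_iff_cls_eq hCtr hCP hM hvar
  refine ⟨CEM.cls p₀, fun p => ?_, hiff, ?_⟩
  · rw [← hiff p]
    exact ⟨P.isVariationalSolution_of_isSolution hM, P.isSolution_of_isVariationalSolution hT⟩
  · refine (Submodule.Quotient.norm_mk_le _ p₀).trans ?_
    -- The orthogonal representative satisfies `‖p₀‖² ≤ K B(p₀,p₀) = K I·U ≤ K |I| ‖p₀‖`; one factor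
    -- `‖p₀‖` is cancelled unless it is zero.
    have h1 := P.norm_sq_le_of_orthogonal hCtr hCP hM hp₀
    have h2 : P.B y p₀ p₀ ≤ ‖I‖ * ‖p₀‖ := by
      rw [← P.formL_apply hT, hsol]
      exact (real_inner_le_norm I p₀.snd).trans
        (mul_le_mul_of_nonneg_left (CEM.Setup.norm_snd_le p₀) (norm_nonneg _))
    have h3 := h1.trans (mul_le_mul_of_nonneg_left h2 hK.le)
    rcases (norm_nonneg p₀).eq_or_lt with h0 | h0
    · rw [← h0]
      exact mul_nonneg hK.le (norm_nonneg _)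
    · rw [sq, ← mul_assoc] at h3
      exact le_of_mul_le_mul_right h3 h0
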